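/- **Setting.** Consider the superline with even coordinate $x$ ranging over an open interval $I\subseteq\mathbb R$ and odd coordinate $\xi$, over a base with even parameters $t$ in an open set $U\subseteq\mathbb R^r$ and odd parameters $\eta_1,\dots,\eta_s$; its functions form the commutative superalgebra $\mathcal O=C^\infty(I\times U)\otimes\Lambda(\xi,\eta_1,\dots,\eta_s)$. Let $D=\partial_\xi+\xi\partial_x$, so that $D^2=\partial_x$. Constants are the elements of $\mathcal O$ that do not depend on $x$ and $\xi$ (they may depend on $t,\eta$). For a square matrix $A$ whose rows and columns carry parities, with blocks $A_{00},A_{01},A_{10},A_{11}$ (extracted with the order of the rows and columns of each parity preserved), put $$\mathrm{Ber}\,A=\frac{\det(A_{00}-A_{01}A_{11}^{-1}A_{10})}{\det A_{11}},\qquad \mathrm{Ber}^*A=\mathrm{Ber}\,A^{\Pi}=\frac{\det(A_{11}-A_{10}A_{00}^{-1}A_{01})}{\det A_{00}},$$ which are defined when $A_{11}$, respectively $A_{00}$, is invertible. The same formulas are used for a "wrong" matrix, obtained from an even matrix by replacing one even row (for $\mathrm{Ber}$), respectively one odd row (for $\mathrm{Ber}^*$), by an odd row vector. **Theorem.** Let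 $M=D^n+a_1D^{n-1}+\dots+a_{n-1}D+a_n$ with $a_1,\dots,a_n\in\mathcal O$, and let $\varphi_0,\dots,\varphi_{n-1}$ be a basis of $\operatorname{Ker}M$ over the constants, where $\varphi_j$ has parity $j \bmod 2$. Let $\mathcal W=(D^i\varphi_j)_{i,j=0,\dots,n-1}$ be the Wroński matrix, its $i$th row and column having parity $i\bmod 2$. Then $W=\mathrm{Ber}\,\mathcal W$ and $W^*=\mathrm{Ber}^*\mathcal W$ are defined and invertible. For $0\le i\le n-1$ let $\mathcal W_i$ be $\mathcal W$ with its $i$th row $(D^i\varphi_0,\dots,D^i\varphi_{n-1})$ replaced by $(-D^n\varphi_0,\dots,-D^n\varphi_{n-1})$. Then for every $k=1,\dots,n$ $$a_k=\frac{1}{W}\,\mathrm{Ber}\,\mathcal W_{n-k}\quad\text{if } n-k \text{ is even},\qquad a_k=\frac{1}{W^*}\,\mathrm{Ber}^*\,\mathcal W_{n-k}\quad\text{if } n-k\text{ is odd},$$ the Berezinians on the right being defined. Thus $\mathrm{Ber}$ and $\mathrm{Ber}^*$ alternate, starting for $a_1$ with $\mathrm{Ber}$ if $n$ is odd and with $\mathrm{Ber}^*$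 if $n$ is even. -/

import Mathlib

open scoped TensorProduct ContDiff
open TopologicalSpace

noncomputable section

namespace Superline

/-! ### Berezinians of matrices over a (not necessarily commutative) ring -/

section Berezinian

variable {R : Type*} [Ring R] {ι : Type*} [Fintype ι] [LinearOrder ι]

/-- The determinant by the Leibniz formula, each product being taken in the order of the rows.
It is only applied to square matrices whose entries are even, except possibly for one row of odd
entries; the factors of each product then commute, so that their order is irrelevant. -/
def ldet (A : Matrix ι ι R) : R :=
  ∑ σ : Equiv.Perm ι,
    ((Equiv.Perm.sign σ : ℤˣ) : ℤ) •
      ((Finset.univ.sort (fun i j : ι => i ≤ j)).map fun i => A i (σ i)).prod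

/-- `Ber A` makes sense: for the format `p` (`p i` is the parity of the `i`-th row and of the
`i`-th column), the odd-odd block of `A` is invertible. -/
def BerDefined (p : ι → ZMod 2) (A : Matrix ι ι R) : Prop :=
  IsUnit (A.toBlock (fun i => p i = 1) (fun i => p i = 1))

/-- The Berezinian `det (A₀₀ - A₀₁ A₁₁⁻¹ A₁₀) / det A₁₁` of a square matrix of format `p`. The
blocks are made of the rows and columns of the indicated parities, with their order preserved. The
value is meaningful when `BerDefined p A` holds. -/
def Ber (p : ι → ZMod 2) (A : Matrix ι ι R) : R :=
  ldet (A.toBlock (fun i => p i = 0) (fun i => p i = 0) -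
      A.toBlock (fun i => p i = 0) (fun i => p i = 1) *
        Ring.inverse (A.toBlock (fun i => p i = 1) (fun i => p i = 1)) *
        A.toBlock (fun i => p i = 1) (fun i => p i = 0)) *
    Ring.inverse (ldet (A.toBlock (fun i => p i = 1) (fun i => p i = 1)))

/-- `Ber* A` makes sense: `Ber` of the parity-reversed matrix does. -/
def BerStarDefined (p : ι → ZMod 2) (A : Matrix ι ι R) : Prop :=
  BerDefined (fun i => p i + 1) A

/-- The inverse Berezinian: `Ber* A = Ber (A^Π)`, where the parity reversion `Π` changes the
parities of all rows and columns and leaves the entries as they are. -/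
def BerStar (p : ι → ZMod 2) (A : Matrix ι ι R) : R :=
  Ber (fun i => p i + 1) A

end Berezinian

/-! ### Smooth functions on an open subset of `ℝ × ℝ^r` and their derivative in the first
coordinate -/

section Smooth

variable {r : ℕ}

/-- The extension by zero of a function on `Ω`. -/
def ext {Ω : Opens (ℝ × (Fin r → ℝ))} (f : Ω → ℝ) : ℝ × (Fin r → ℝ) → ℝ :=
  open Classical in fun z => if h : z ∈ Ω then f ⟨z, h⟩ else 0

lemma ext_of_mem {Ω : Opens (ℝ × (Fin r → ℝ))} (f : Ω → ℝ) {z : ℝ × (Fin r → ℝ)} (h : z ∈ Ω) :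
    ext f z = f ⟨z, h⟩ := by
  simp [ext, h]

/-- The domain `I × U` of the even variables `(x, t)`. -/
def domain (I : Opens ℝ) (U : Opens (Fin r → ℝ)) : Opens (ℝ × (Fin r → ℝ)) :=
  ⟨(I : Set ℝ) ×ˢ (U : Set (Fin r → ℝ)), I.isOpen.prod U.isOpen⟩

/-- The algebra of smooth real functions on the open set `Ω`. -/
def smoothFn (Ω : Opens (ℝ × (Fin r → ℝ))) : Subalgebra ℝ (Ω → ℝ) where
  carrier := {f | ContDiffOn ℝ ∞ (ext f) Ω}
  mul_mem' {f g} hf hg := by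
    refine (ContDiffOn.mul hf hg).congr fun z hz => ?_
    have hz' : z ∈ Ω := hz
    simp [ext_of_mem _ hz']
  add_mem' {f g} hf hg := by
    refine (ContDiffOn.add hf hg).congr fun z hz => ?_
    have hz' : z ∈ Ω := hz
    simp [ext_of_mem _ hz']
  algebraMap_mem' c := by
    refine (contDiffOn_const (c := c)).congr fun z hz => ?_
    have hz' : z ∈ Ω := hz
    simp [ext_of_mem _ hz']

/-- The partial derivative in the first coordinate `x`, as a function on `Ω`. -/
def pderivFun {Ω : Opens (ℝ × (Fin r → ℝ))} (f : Ω → ℝ) : Ω → ℝ :=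
  fun z => fderiv ℝ (ext f) z.1 (1, 0)

lemma pderivFun_mem {Ω : Opens (ℝ × (Fin r → ℝ))} {f : Ω → ℝ} (hf : f ∈ smoothFn Ω) :
    pderivFun f ∈ smoothFn Ω := by
  have h1 : ContDiffOn ℝ ∞ (fderiv ℝ (ext f)) Ω :=
    ContDiffOn.fderiv_of_isOpen hf Ω.isOpen (by simp)
  refine (h1.clm_apply (contDiffOn_const (c := ((1 : ℝ), (0 : Fin r → ℝ))))).congr
    fun z hz => ?_
  have hz' : z ∈ Ω := hz
  simp [ext_of_mem _ hz', pderivFun]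

lemma differentiableAt_ext {Ω : Opens (ℝ × (Fin r → ℝ))} {f : Ω → ℝ} (hf : f ∈ smoothFn Ω)
    (z : Ω) : DifferentiableAt ℝ (ext f) z.1 :=
  (ContDiffOn.contDiffAt (n := ∞) hf (Ω.isOpen.mem_nhds z.2)).differentiableAt (by simp)

/-- The partial derivative `∂/∂x` as a linear endomorphism of the algebra of smooth functions. -/
def pderiv (Ω : Opens (ℝ × (Fin r → ℝ))) : smoothFn Ω →ₗ[ℝ] smoothFn Ω where
  toFun f := ⟨pderivFun f.1, pderivFun_mem f.2⟩
  map_add' f g := by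
    apply Subtype.ext
    funext z
    have h : ext (f.1 + g.1) = ext f.1 + ext g.1 := by
      funext w
      by_cases hw : w ∈ Ω <;> simp [ext, hw]
    change fderiv ℝ (ext (f.1 + g.1)) z.1 (1, 0) = _
    rw [h, fderiv_add (differentiableAt_ext f.2 z) (differentiableAt_ext g.2 z)]
    rfl
  map_smul' c f := by
    apply Subtype.ext
    funext z
    have h : ext (c • f.1) = c • ext f.1 := by
      funext w
      by_cases hw : w ∈ Ω <;> simp [ext, hw]
    change fderiv ℝ (ext (c • f.1)) z.1 (1, 0) = _
    rw [h, fderiv_const_smul (differentiableAt_ext f.2 z)]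
    rfl

end Smooth

/-! ### Functions on the superline, with even and odd external parameters -/

section Functions

variable {r : ℕ}

/-- The Grassmann algebra on `s + 1` odd generators: the odd coordinate `ξ` of the superline
(index `0`) and the external odd parameters `η₁, …, η_s` (the other indices). -/
abbrev Grassmann (s : ℕ) : Type := ExteriorAlgebra ℝ (Fin (s + 1) → ℝ)

/-- The superalgebra `C^∞(Ω) ⊗ Λ(ξ, η₁, …, η_s)` of functions of the even variable `x`, the odd
variable `ξ`, `r` external even parameters and `s` external odd parameters, where `(x, t)` runs
over `Ω`. -/
def SFun (Ω : Opens (ℝ × (Fin r → ℝ))) (s : ℕ) : Type := smoothFn Ω ⊗[ℝ] Grassmann s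

instance (Ω : Opens (ℝ × (Fin r → ℝ))) (s : ℕ) : Ring (SFun Ω s) :=
  inferInstanceAs (Ring (smoothFn Ω ⊗[ℝ] Grassmann s))

instance (Ω : Opens (ℝ × (Fin r → ℝ))) (s : ℕ) : Algebra ℝ (SFun Ω s) :=
  inferInstanceAs (Algebra ℝ (smoothFn Ω ⊗[ℝ] Grassmann s))

variable (Ω : Opens (ℝ × (Fin r → ℝ))) (s : ℕ)

/-- The functions of parity `i`. -/
def parity (i : ZMod 2) : Submodule ℝ (SFun Ω s) :=
  LinearMap.range
    ((CliffordAlgebra.evenOdd (0 : QuadraticForm ℝ (Fin (s + 1) → ℝ)) i).subtype.lTensor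
      (smoothFn Ω))

/-- The odd coordinate `ξ`. -/
def xi : SFun Ω s := (1 : smoothFn Ω) ⊗ₜ[ℝ] ExteriorAlgebra.ι ℝ (Pi.single 0 1)

/-- The even vector field `∂_x`, acting on the coefficients. -/
def dx : Module.End ℝ (SFun Ω s) := (pderiv Ω).rTensor (Grassmann s)

/-- The odd vector field `∂_ξ` (left derivative): the contraction with the coordinate functional
dual to `ξ`. -/
def dxi : Module.End ℝ (SFun Ω s) :=
  LinearMap.lTensor (smoothFn Ω)
    (CliffordAlgebra.contractLeft (Q := (0 : QuadraticForm ℝ (Fin (s + 1) → ℝ)))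
      (LinearMap.proj 0))

/-- The superderivative `D = ∂_ξ + ξ ∂_x`. -/
def D : Module.End ℝ (SFun Ω s) := dxi Ω s + LinearMap.mulLeft ℝ (xi Ω s) * dx Ω s

variable {Ω s}

/-- Constants: functions that depend neither on `x` nor on `ξ` (but possibly on the external
parameters). -/
def IsConst (f : SFun Ω s) : Prop := dx Ω s f = 0 ∧ dxi Ω s f = 0

/-- The monic differential operator `D^n + a₁ D^(n-1) + ⋯ + a_n` of order `n`. -/
def monicOp (n : ℕ) (a : ℕ → SFun Ω s) : Module.End ℝ (SFun Ω s) :=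
  D Ω s ^ n + ∑ k ∈ Finset.Icc 1 n, LinearMap.mulLeft ℝ (a k) * D Ω s ^ (n - k)

/-- `φ₀, …, φ_(n-1)` is a homogeneous basis of `Ker M` over the constants, with `φ_j` of parity
`j mod 2`. -/
structure IsKerBasis {n : ℕ} (M : Module.End ℝ (SFun Ω s)) (φ : Fin n → SFun Ω s) : Prop where
  mem_ker : ∀ j, M (φ j) = 0
  mem_parity : ∀ j : Fin n, φ j ∈ parity Ω s ((j : ℕ) : ZMod 2)
  existsUnique : ∀ f, M f = 0 →
    ∃! c : Fin n → SFun Ω s, (∀ j, IsConst (c j)) ∧ f = ∑ j : Fin n, φ j * c j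

/-- The format of the Wroński matrix: the parity of the `i`-th row and column is `i mod 2`. -/
def altParity (n : ℕ) (i : Fin n) : ZMod 2 := ((i : ℕ) : ZMod 2)

/-- The Wroński matrix, with entries `D^i φ_j`. -/
def wronskiMatrix {n : ℕ} (φ : Fin n → SFun Ω s) : Matrix (Fin n) (Fin n) (SFun Ω s) :=
  Matrix.of fun i j => (D Ω s ^ (i : ℕ)) (φ j)

/-- The superwronskian `W`. -/
def wronskian {n : ℕ} (φ : Fin n → SFun Ω s) : SFun Ω s :=
  Ber (altParity n) (wronskiMatrix φ)

/-- The inverse superwronskian `W*`. -/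
def wronskianStar {n : ℕ} (φ : Fin n → SFun Ω s) : SFun Ω s :=
  BerStar (altParity n) (wronskiMatrix φ)

/-- The Wroński matrix with its `i`-th row replaced by `(-D^n φ₀, …, -D^n φ_(n-1))`. -/
def replacedMatrix {n : ℕ} (φ : Fin n → SFun Ω s) (i : Fin n) :
    Matrix (Fin n) (Fin n) (SFun Ω s) :=
  (wronskiMatrix φ).updateRow i fun j => -((D Ω s ^ n) (φ j))

end Functions

end Superline

end

noncomputable section

namespace Superline

/-! ### Linear differential equations with parameters -/

/-! ### Smooth functions of a time and a parameter as smooth families of paths -/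

section Slices

variable {P E : Type} [NormedAddCommGroup P] [NormedSpace ℝ P] [NormedAddCommGroup E]
  [NormedSpace ℝ E]

/-! The formula is Cramer's rule. The equations `M φ_j = 0` say that the row `-D^n φ_j` is the left
combination of the rows `D^l φ_j` with coefficients `a_(n-l)`, so the claim for an even row `i` is
that replacing it by this combination multiplies `Ber` by the coefficient `a_(n-i)`, on the left.
The coefficients may have any parity, so the new row may be wrong. The rule survives because the
Schur complement of an even matrix has even, hence central, entries: a Leibniz determinant whose
other rows are central is left linear in the remaining row (`ldet_updateRow_sum`), and the odd rows
drop out since elimination of the odd columns makes them zero (`schur_updateRow_sum`). For an odd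
row all parities are shifted by one, which turns `Ber` into `Ber*` and makes the row even.

It remains to divide by the Berezinians, so the Wroński matrix must be shown invertible.
Invertibility can be tested on bodies, since the odd variables are nilpotent
(`isUnit_of_forall_isUnit_bodyAt`). At a point `z`, the kernel of `M` contains solutions whose
derivatives `D^i f`, `i < n`, have the standard unit vectors as bodies at `z`
(`exists_mem_ker_monicOp`). Expanding these solutions in the basis `φ` over the constants gives a
right inverse of the body of the Wroński matrix. That body is block diagonal, so both diagonal
blocks are invertible, which serves `Ber` and `Ber*` alike (`BerDefined_and_isUnit_Ber`).

The Cauchy problem is solved by passing from `M f = 0` to a companion system `D F = A F`, then to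
its consequence `∂_x F = B F`, whose components along the Grassmann monomials form a real linear
system with parameters `t`. Such a system has a smooth solution on the whole of `I × U`, obtained by
inverting `1 - volterra` (`exists_contDiffOn_solution`). -/

/-- A continuous family of linear maps as a linear map into the continuous functions. -/
def familyCLM (P E : Type) [NormedAddCommGroup P] [NormedSpace ℝ P] [NormedAddCommGroup E]
    [NormedSpace ℝ E] : C(unitInterval, P →L[ℝ] E) →L[ℝ] P →L[ℝ] C(unitInterval, E) :=
  LinearMap.mkContinuous₂
    (LinearMap.mk₂ ℝ
      (fun (Φ : C(unitInterval, P →L[ℝ] E)) (v : P) =>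
        (⟨fun τ => Φ τ v, by fun_prop⟩ : C(unitInterval, E)))
      (fun _ _ _ => by ext; simp) (fun _ _ _ => by ext; simp)
      (fun _ _ _ => by ext; simp) (fun _ _ _ => by ext; simp))
    1 (fun Φ v => by
      rw [ContinuousMap.norm_le _ (by positivity)]
      intro τ
      rw [one_mul]
      exact (Φ τ).le_of_opNorm_le (Φ.norm_coe_le_norm τ) v)

@[simp] lemma familyCLM_apply (Φ : C(unitInterval, P →L[ℝ] E)) (v : P) (τ : unitInterval) :
    familyCLM P E Φ v τ = Φ τ v := rfl

lemma contDiff_familyCLM (P E : Type) [NormedAddCommGroup P] [NormedSpace ℝ P]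
    [NormedAddCommGroup E] [NormedSpace ℝ E] (n : WithTop ℕ∞) :
    ContDiff ℝ n fun Φ => familyCLM P E Φ := by
  have h := ContinuousLinearMap.contDiff (𝕜 := ℝ) (n := n)
    (E := C(unitInterval, P →L[ℝ] E)) (F := P →L[ℝ] C(unitInterval, E))
  exact @h (familyCLM P E)

omit [NormedSpace ℝ P] [NormedSpace ℝ E] in
lemma continuousOn_slice {O : Set (ℝ × P)} {S : Set P}
    (hSO : ∀ τ : unitInterval, ∀ p ∈ S, ((τ : ℝ), p) ∈ O) {h : ℝ × P → E}
    (hh : ContinuousOn h O) {G : P → C(unitInterval, E)}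
    (hG : ∀ p ∈ S, ∀ τ, G p τ = h (τ, p)) : ContinuousOn G S := by
  apply ContinuousMap.continuousOn_of_continuousOn_uncurry
  have : ContinuousOn (fun q : P × unitInterval => h ((q.2 : ℝ), q.1)) (S ×ˢ Set.univ) :=
    hh.comp (by fun_prop) (fun q hq => hSO q.2 q.1 hq.1)
  exact this.congr fun q hq => hG q.1 hq.1 q.2

/-- The norm of a path is a supremum over `τ`, so the remainder must be small uniformly in `τ`.
Continuity of `H` bounds the variation of the partial derivative uniformly in `τ`, and the mean
value inequality on a ball does the rest. -/
lemma hasFDerivAt_slice {S : Set P} (hS : IsOpen S) {h : ℝ × P → E} {h' : ℝ × P → P →L[ℝ] E}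
    (hd : ∀ τ : unitInterval, ∀ p ∈ S, HasFDerivAt (fun q => h (τ, q)) (h' (τ, p)) p)
    {G : P → C(unitInterval, E)} (hG : ∀ p ∈ S, ∀ τ, G p τ = h (τ, p))
    {H : P → C(unitInterval, P →L[ℝ] E)} (hH : ∀ p ∈ S, ∀ τ, H p τ = h' (τ, p))
    (hHc : ContinuousOn H S) {p : P} (hp : p ∈ S) :
    HasFDerivAt G (familyCLM P E (H p)) p := by
  rw [hasFDerivAt_iff_isLittleO, Asymptotics.isLittleO_iff]
  intro ε hε
  have h1 : ∀ᶠ q in nhds p, q ∈ S ∧ ∀ τ, dist (H p τ) (H q τ) < ε := by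
    refine Filter.Eventually.and (hS.mem_nhds hp) ?_
    exact Metric.tendstoUniformly_iff.1 (ContinuousMap.tendsto_iff_tendstoUniformly.1
      (hHc.continuousAt (hS.mem_nhds hp))) ε hε
  obtain ⟨δ, hδ, hball⟩ := Metric.eventually_nhds_iff_ball.1 h1
  filter_upwards [Metric.ball_mem_nhds p hδ] with q hq
  rw [ContinuousMap.norm_le _ (by positivity)]
  intro τ
  simp only [ContinuousMap.sub_apply, familyCLM_apply]
  rw [hG q (hball q hq).1, hG p hp]
  refine Convex.norm_image_sub_le_of_norm_hasFDerivWithin_le' (𝕜 := ℝ)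
    (f := fun q => h (τ, q)) (f' := fun q => h' (τ, q)) (s := Metric.ball p δ)
    (fun x hx => (hd τ x (hball x hx).1).hasFDerivWithinAt) (fun x hx => ?_)
    (convex_ball p δ) (Metric.mem_ball_self hδ) hq
  rw [← hH x (hball x hx).1, ← dist_eq_norm, dist_comm]
  exact ((hball x hx).2 τ).le

/-- A smooth function of `(τ, p)` is smooth in `p` as a map into the continuous functions
of `τ`. -/
theorem contDiffOn_slice {O : Set (ℝ × P)} (hO : IsOpen O) {S : Set P} (hS : IsOpen S)
    (hSO : ∀ τ : unitInterval, ∀ p ∈ S, ((τ : ℝ), p) ∈ O) (n : ℕ) :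
    ∀ {E : Type} [NormedAddCommGroup E] [NormedSpace ℝ E] {h : ℝ × P → E}
    (_ : ContDiffOn ℝ n h O) {G : P → C(unitInterval, E)}
    (_ : ∀ p ∈ S, ∀ τ, G p τ = h (τ, p)), ContDiffOn ℝ n G S := by
  -- The target space stays universally quantified in the induction: the derivative takes values in
  -- `P →L[ℝ] E`, and the induction hypothesis is applied there.
  induction n with
  | zero =>
    intro E _ _ h hh G hG
    exact contDiffOn_zero.2 (continuousOn_slice hSO hh.continuousOn hG)
  | succ n ih =>
    intro E _ _ h hh G hG
    rw [Nat.cast_succ] at hh ⊢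
    have hh' := (contDiffOn_succ_iff_fderiv_of_isOpen hO).1 hh
    -- `L` restricts a derivative on `ℝ × P` to the parameter directions.
    let L := (ContinuousLinearMap.compL ℝ P (ℝ × P) E).flip (ContinuousLinearMap.inr ℝ ℝ P)
    have hc : ContDiffOn ℝ n (fun z => L (fderiv ℝ h z)) O := L.contDiff.comp_contDiffOn hh'.2.2
    let H : P → C(unitInterval, P →L[ℝ] E) := fun p =>
      ContinuousMap.mkD (fun τ : unitInterval => L (fderiv ℝ h (τ, p))) 0
    have hH : ∀ p ∈ S, ∀ τ, H p τ = L (fderiv ℝ h (τ, p)) := by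
      intro p hp τ
      refine ContinuousMap.mkD_apply_of_continuous ?_
      exact continuousOn_univ.1 (hc.continuousOn.comp (by fun_prop)
        (fun τ _ => hSO τ p hp) : ContinuousOn (fun τ : unitInterval => _) Set.univ)
    have hHc := ih hc hH
    have hG' : ∀ p ∈ S, HasFDerivAt G (familyCLM P E (H p)) p := by
      intro p hp
      refine hasFDerivAt_slice hS (h := h) (h' := fun z => L (fderiv ℝ h z)) (fun τ p hp => ?_)
        hG hH hHc.continuousOn hp
      have h1 : HasFDerivAt h (fderiv ℝ h ((τ : ℝ), p)) ((τ : ℝ), p) :=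
        (hh'.1.differentiableAt (hO.mem_nhds (hSO τ p hp))).hasFDerivAt
      exact h1.comp p (hasFDerivAt_prodMk_right (τ : ℝ) p)
    refine (contDiffOn_succ_iff_fderiv_of_isOpen hS).2
      ⟨fun p hp => (hG' p hp).differentiableAt.differentiableWithinAt, by simp, ?_⟩
    exact ((contDiff_familyCLM P E n).comp_contDiffOn hHc).congr fun p hp => (hG' p hp).fderiv

end Slices

/-! ### Volterra integral equations -/

section Volterra

variable {V : Type} [NormedAddCommGroup V] [NormedSpace ℝ V]

/-- The operator of integration from `0`. -/
def integralCLM (V : Type) [NormedAddCommGroup V] [NormedSpace ℝ V] :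
    C(unitInterval, V) →L[ℝ] C(unitInterval, V) :=
  LinearMap.mkContinuous
    { toFun := fun y => ⟨fun τ => ∫ u in (0 : ℝ)..τ, y (Set.projIcc 0 1 zero_le_one u), by
        have hy : Continuous fun u : ℝ => y (Set.projIcc 0 1 zero_le_one u) := by fun_prop
        exact (intervalIntegral.continuous_primitive
          (fun a b => hy.intervalIntegrable a b) 0).comp continuous_subtype_val⟩
      map_add' := fun y z => by
        have (w : C(unitInterval, V)) : Continuous fun u : ℝ =>
          w (Set.projIcc 0 1 zero_le_one u) := by fun_prop
        ext τ
        exact intervalIntegral.integral_add ((this y).intervalIntegrable _ _)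
          ((this z).intervalIntegrable _ _)
      map_smul' := fun c y => by
        ext τ
        exact intervalIntegral.integral_smul c _ }
    1 (fun y => by
      rw [ContinuousMap.norm_le _ (by positivity)]
      intro τ
      have := intervalIntegral.norm_integral_le_of_norm_le_const (a := (0 : ℝ)) (b := τ)
        (f := fun u => y (Set.projIcc 0 1 zero_le_one u)) (C := ‖y‖)
        (fun u _ => y.norm_coe_le_norm _)
      refine this.trans ?_
      rw [sub_zero, abs_of_nonneg τ.2.1, mul_comm]
      exact mul_le_mul_of_nonneg_right τ.2.2 (norm_nonneg _))

/-- Pointwise application of a family of operators. -/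
def pointwiseCLM (V : Type) [NormedAddCommGroup V] [NormedSpace ℝ V] :
    C(unitInterval, V →L[ℝ] V) →L[ℝ] C(unitInterval, V) →L[ℝ] C(unitInterval, V) :=
  LinearMap.mkContinuous₂
    (LinearMap.mk₂ ℝ
      (fun (Φ : C(unitInterval, V →L[ℝ] V)) (y : C(unitInterval, V)) =>
        (⟨fun τ => Φ τ (y τ), by fun_prop⟩ : C(unitInterval, V)))
      (fun _ _ _ => by ext; simp) (fun _ _ _ => by ext; simp)
      (fun _ _ _ => by ext; simp) (fun _ _ _ => by ext; simp))
    1 (fun Φ y => by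
      rw [ContinuousMap.norm_le _ (by positivity)]
      intro τ
      rw [one_mul]
      exact (Φ τ).le_of_opNorm_le_of_le (Φ.norm_coe_le_norm τ) (y.norm_coe_le_norm τ))

/-- The Volterra operator `y ↦ ∫₀^τ Φ y`. -/
def volterra (V : Type) [NormedAddCommGroup V] [NormedSpace ℝ V] :
    C(unitInterval, V →L[ℝ] V) →L[ℝ] C(unitInterval, V) →L[ℝ] C(unitInterval, V) :=
  (ContinuousLinearMap.compL ℝ _ _ _ (integralCLM V)).comp (pointwiseCLM V)

lemma contDiff_volterra (V : Type) [NormedAddCommGroup V] [NormedSpace ℝ V] (n : WithTop ℕ∞) :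
    ContDiff ℝ n fun Φ => volterra V Φ := by
  have h := ContinuousLinearMap.contDiff (𝕜 := ℝ) (n := n)
    (E := C(unitInterval, V →L[ℝ] V)) (F := C(unitInterval, V) →L[ℝ] C(unitInterval, V))
  exact @h (volterra V)

lemma volterra_apply (Φ : C(unitInterval, V →L[ℝ] V)) (y : C(unitInterval, V))
    (τ : unitInterval) :
    volterra V Φ y τ = ∫ u in (0 : ℝ)..τ, Φ (Set.projIcc 0 1 zero_le_one u)
      (y (Set.projIcc 0 1 zero_le_one u)) := rfl

/-- Iterated integration from `0` produces the volume `τ ^ m / m!` of a simplex; the pointwise bound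
in `τ` is what makes the induction work. -/
lemma norm_volterra_pow_apply_le (Φ : C(unitInterval, V →L[ℝ] V)) (y : C(unitInterval, V))
    (m : ℕ) (τ : unitInterval) :
    ‖((volterra V Φ) ^ m) y τ‖ ≤ ‖Φ‖ ^ m * ((τ : ℝ) ^ m / m.factorial) * ‖y‖ := by
  induction m generalizing τ with
  | zero => simpa using y.norm_coe_le_norm τ
  | succ m ih =>
    rw [pow_succ', mul_apply_eq_comp, volterra_apply]
    have hb : ∀ u ∈ Set.Ioc (0 : ℝ) τ, ‖Φ (Set.projIcc 0 1 zero_le_one u)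
        ((((volterra V Φ) ^ m) y) (Set.projIcc 0 1 zero_le_one u))‖ ≤
          ‖Φ‖ * (‖Φ‖ ^ m * (u ^ m / m.factorial) * ‖y‖) := by
      intro u hu
      have hu' : u ∈ Set.Icc (0 : ℝ) 1 := ⟨hu.1.le, hu.2.trans τ.2.2⟩
      rw [Set.projIcc_of_mem _ hu']
      exact (Φ _).le_of_opNorm_le_of_le (Φ.norm_coe_le_norm _) (ih ⟨u, hu'⟩)
    refine (intervalIntegral.norm_integral_le_of_norm_le τ.2.1
      (Filter.Eventually.of_forall hb) ?_).trans (le_of_eq ?_)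
    · exact Continuous.intervalIntegrable (by fun_prop) _ _
    · have : ∀ u : ℝ, ‖Φ‖ * (‖Φ‖ ^ m * (u ^ m / m.factorial) * ‖y‖) =
          (‖Φ‖ ^ (m + 1) * ‖y‖ / m.factorial) * u ^ m := fun u => by ring
      simp_rw [this]
      rw [intervalIntegral.integral_const_mul, integral_pow, Nat.factorial_succ]
      push_cast
      field_simp
      simp

/-- By the factorial bound some power `T ^ m` has norm below one, so `1 - T ^ m` is invertible. It
is the product of `1 - T` and a geometric sum commuting with it, so `1 - T` is invertible too, with
no smallness assumption on `Φ`. -/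
theorem isUnit_one_sub_volterra [CompleteSpace V] (Φ : C(unitInterval, V →L[ℝ] V)) :
    IsUnit (1 - volterra V Φ) := by
  have hlim := FloorSemiring.tendsto_pow_div_factorial_atTop ‖Φ‖
  obtain ⟨m, hm⟩ := (hlim.eventually (gt_mem_nhds zero_lt_one)).exists
  have hnorm : ‖(volterra V Φ) ^ m‖ < 1 := by
    refine lt_of_le_of_lt (ContinuousLinearMap.opNorm_le_bound _ (by positivity)
      (fun y => ?_)) hm
    rw [ContinuousMap.norm_le _ (by positivity)]
    intro τ
    refine (norm_volterra_pow_apply_le Φ y m τ).trans ?_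
    rw [← mul_div_assoc]
    gcongr
    exact mul_le_of_le_one_right (by positivity) (pow_le_one₀ τ.2.1 τ.2.2)
  have hu := isUnit_one_sub_of_norm_lt_one
    (R := C(unitInterval, V) →L[ℝ] C(unitInterval, V)) hnorm
  rw [← mul_neg_geom_sum] at hu
  refine ((Commute.isUnit_mul_iff ?_).1 hu).1
  exact Commute.sum_right _ _ _ fun i _ => (Commute.sub_left (Commute.one_left _)
    ((Commute.refl _).pow_right i))

/-- The solution of the integral equation `z = c + ∫₀^τ Φ z`. -/
def volterraSol (Φ : C(unitInterval, V →L[ℝ] V)) (c : V) : C(unitInterval, V) :=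
  Ring.inverse (1 - volterra V Φ) (ContinuousMap.const _ c)

lemma volterraSol_unique [CompleteSpace V] {Φ : C(unitInterval, V →L[ℝ] V)} {c : V}
    {z : C(unitInterval, V)} :
    z = volterraSol Φ c ↔ ∀ τ, z τ = c + volterra V Φ z τ := by
  have hu := isUnit_one_sub_volterra Φ
  have h1 : z = volterraSol Φ c ↔ (1 - volterra V Φ) z = ContinuousMap.const _ c := by
    constructor
    · rintro rfl
      rw [volterraSol, ← mul_apply_eq_comp, Ring.mul_inverse_cancel _ hu]
      rfl
    · intro h
      rw [volterraSol, ← h, ← mul_apply_eq_comp, Ring.inverse_mul_cancel _ hu]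
      rfl
  rw [h1, ContinuousMap.ext_iff]
  refine forall_congr' fun τ => ?_
  simp [sub_eq_iff_eq_add]

lemma volterraSol_apply [CompleteSpace V] (Φ : C(unitInterval, V →L[ℝ] V)) (c : V)
    (τ : unitInterval) : volterraSol Φ c τ = c + volterra V Φ (volterraSol Φ c) τ :=
  volterraSol_unique.1 rfl τ

/-- Inversion in a Banach algebra is smooth at units, and the Volterra operator depends linearly and
continuously on the family. -/
lemma contDiffOn_volterraSol [CompleteSpace V] {P : Type} [NormedAddCommGroup P]
    [NormedSpace ℝ P] {S : Set P} (hS : IsOpen S) {n : WithTop ℕ∞}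
    {G : P → C(unitInterval, V →L[ℝ] V)}
    (hG : ContDiffOn ℝ n G S) (c : V) : ContDiffOn ℝ n (fun p => volterraSol (G p) c) S := by
  intro p hp
  have h1 : ContDiffAt ℝ n (fun p => 1 - volterra V (G p)) p :=
    contDiffAt_const.sub ((contDiff_volterra V n).contDiffAt.comp p
      (hG.contDiffAt (hS.mem_nhds hp)))
  obtain ⟨u, hu⟩ := isUnit_one_sub_volterra (G p)
  have h2 : ContDiffAt ℝ n Ring.inverse (1 - volterra V (G p)) := by
    have h := contDiffAt_ringInverse (R := C(unitInterval, V) →L[ℝ] C(unitInterval, V)) ℝ (n := n)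
    rw [← hu]
    exact @h u
  exact ((h2.comp p h1).clm_apply contDiffAt_const).contDiffWithinAt

end Volterra

/-! ### Linear differential equations with smooth parameters -/

section ODE

variable {Q V : Type} [NormedAddCommGroup Q] [NormedSpace ℝ Q] [NormedAddCommGroup V]
  [NormedSpace ℝ V] [CompleteSpace V]

omit [CompleteSpace V] in
lemma contDiff_evalCLM (τ : unitInterval) (n : WithTop ℕ∞) :
    ContDiff ℝ n fun y : C(unitInterval, V) => y τ := by
  have h := ContinuousLinearMap.contDiff (𝕜 := ℝ) (n := n) (E := C(unitInterval, V)) (F := V)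
  exact @h (ContinuousMap.evalCLM ℝ τ)

/-- The substitution `u ↦ l * u` shows that the slowed-down solution satisfies the integral equation
of `Ψ`, so uniqueness applies. This compares the problems on the segments from `x₀` to different
endpoints. -/
lemma volterraSol_rescale {Φ Ψ : C(unitInterval, V →L[ℝ] V)} {l : unitInterval}
    (h : ∀ τ, Ψ τ = (l : ℝ) • Φ (l * τ)) (c : V) (τ : unitInterval) :
    volterraSol Ψ c τ = volterraSol Φ c (l * τ) := by
  let w : C(unitInterval, V) := ⟨fun τ => volterraSol Φ c (l * τ), by fun_prop⟩
  have hw : w = volterraSol Ψ c := by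
    rw [volterraSol_unique]
    intro τ
    change volterraSol Φ c (l * τ) = _
    rw [volterraSol_apply, volterra_apply, volterra_apply]
    congr 1
    have := intervalIntegral.smul_integral_comp_mul_left (a := 0) (b := (τ : ℝ))
      (fun u => Φ (Set.projIcc 0 1 zero_le_one u)
        (volterraSol Φ c (Set.projIcc 0 1 zero_le_one u))) (l : ℝ)
    rw [mul_zero] at this
    rw [Set.Icc.coe_mul, ← this, ← intervalIntegral.integral_smul]
    refine intervalIntegral.integral_congr fun u hu => ?_
    rw [Set.uIcc_of_le τ.2.1] at hu
    have hu' : u ∈ Set.Icc (0 : ℝ) 1 := ⟨hu.1, hu.2.trans τ.2.2⟩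
    have hlu : (l : ℝ) * u ∈ Set.Icc (0 : ℝ) 1 := (l * ⟨u, hu'⟩ : unitInterval).2
    have he : Set.projIcc (0 : ℝ) 1 zero_le_one (l * u) =
        l * Set.projIcc (0 : ℝ) 1 zero_le_one u := by
      rw [Set.projIcc_of_mem _ hlu, Set.projIcc_of_mem _ hu']
      rfl
    simp only [he, h]
    rfl
  rw [← hw]
  rfl

/-- A linear differential equation depending smoothly on parameters has a smooth solution with
prescribed constant initial value, over the whole interval of definition. -/
theorem exists_contDiffOn_solution {I : Set ℝ} (hIo : IsOpen I) (hI : I.OrdConnected) {U : Set Q}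
    (hU : IsOpen U) {B : ℝ × Q → V →L[ℝ] V} (hB : ContDiffOn ℝ ∞ B (I ×ˢ U)) {x₀ : ℝ}
    (hx₀ : x₀ ∈ I) (c : V) :
    ∃ y : ℝ × Q → V, ContDiffOn ℝ ∞ y (I ×ˢ U) ∧
      (∀ p ∈ I ×ˢ U, fderiv ℝ y p (1, 0) = B p (y p)) ∧ ∀ t ∈ U, y (x₀, t) = c := by
  -- `m (τ, p)` runs from `(x₀, t)` to `p` along a segment as `τ` goes from `0` to `1`. The equation
  -- pulled back to it has the coefficient `h` below, and the solution at `p` is its value at time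
  -- `1`. Every `p` thus gets the same time interval.
  let m : ℝ × (ℝ × Q) → ℝ × Q := fun z => (x₀ + z.1 * (z.2.1 - x₀), z.2.2)
  have hm : ContDiff ℝ ∞ m := by fun_prop
  have hS : IsOpen (I ×ˢ U) := hIo.prod hU
  have hmem : ∀ τ : unitInterval, ∀ p ∈ I ×ˢ U, m (τ, p) ∈ I ×ˢ U := by
    intro τ p hp
    refine ⟨?_, hp.2⟩
    have := hI.convex hx₀ hp.1 (sub_nonneg.2 τ.2.2) τ.2.1 (by ring)
    convert this using 1
    simp [m]
    ring
  let h : ℝ × (ℝ × Q) → V →L[ℝ] V := fun z => (z.2.1 - x₀) • B (m z)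
  have hh : ContDiffOn ℝ ∞ h (m ⁻¹' (I ×ˢ U)) :=
    ContDiffOn.smul (f := fun z => z.2.1 - x₀) (by fun_prop)
      (hB.comp hm.contDiffOn fun _ hz => hz)
  have hO : IsOpen (m ⁻¹' (I ×ˢ U)) := hS.preimage hm.continuous
  let G : ℝ × Q → C(unitInterval, V →L[ℝ] V) := fun p =>
    ContinuousMap.mkD (fun τ : unitInterval => h (τ, p)) 0
  have hG : ∀ p ∈ I ×ˢ U, ∀ τ, G p τ = h (τ, p) := by
    intro p hp τ
    refine ContinuousMap.mkD_apply_of_continuous ?_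
    exact continuousOn_univ.1 (hh.continuousOn.comp (by fun_prop)
      (fun τ _ => hmem τ p hp) : ContinuousOn (fun τ : unitInterval => _) Set.univ)
  have hGs : ContDiffOn ℝ ∞ G (I ×ˢ U) := contDiffOn_infty.2 fun n =>
    contDiffOn_slice hO hS hmem n (contDiffOn_infty.1 hh n) hG
  let y : ℝ × Q → V := fun p => volterraSol (G p) c 1
  have hy : ContDiffOn ℝ ∞ y (I ×ˢ U) :=
    (contDiff_evalCLM (1 : unitInterval) ∞).comp_contDiffOn (contDiffOn_volterraSol hS hGs c)
  have hresc : ∀ p ∈ I ×ˢ U, ∀ l : unitInterval, y (m (l, p)) = volterraSol (G p) c l := by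
    intro p hp l
    have := volterraSol_rescale (Φ := G p) (Ψ := G (m (l, p))) (l := l) (fun τ => ?_) c 1
    · rw [mul_one] at this
      exact this
    · rw [hG _ (hmem l p hp), hG _ hp]
      simp only [h, smul_smul]
      congr 1
      · simp [m]
      · congr 1
        simp only [m, Set.Icc.coe_mul]
        ext <;> simp
        ring
  have hdiff : ∀ p ∈ I ×ˢ U, DifferentiableAt ℝ y p := fun p hp =>
    (hy.contDiffAt (hS.mem_nhds hp)).differentiableAt (by simp)
  -- Differentiating along the segment at its endpoint gives the equation only up to the factor `x -
  -- x₀`.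
  have hmul : ∀ p ∈ I ×ˢ U, (p.1 - x₀) • fderiv ℝ y p (1, 0) = (p.1 - x₀) • B p (y p) := by
    intro p hp
    have hm1 : m (1, p) = p := by simp [m]
    let f : ℝ → V := fun u => G p (Set.projIcc 0 1 zero_le_one u)
      (volterraSol (G p) c (Set.projIcc 0 1 zero_le_one u))
    have hf : Continuous f := by fun_prop
    -- The rescaling identity is known only for times in `[0, 1]`, so the derivative at `1` is taken
    -- from within this interval.
    have h1 : HasDerivWithinAt (fun u => y (m (u, p))) (f 1) (Set.Icc 0 1) 1 := by
      have h2 : HasDerivAt (fun u => c + ∫ v in (0 : ℝ)..u, f v) (f 1) 1 :=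
        (intervalIntegral.integral_hasDerivAt_right (hf.intervalIntegrable _ _)
          hf.stronglyMeasurable.stronglyMeasurableAtFilter hf.continuousAt).const_add c
      refine h2.hasDerivWithinAt.congr_of_mem (fun u hu => ?_) (by simp)
      exact (hresc p hp ⟨u, hu⟩).trans (volterraSol_apply _ _ _)
    have h3 : HasDerivAt (fun u => m (u, p)) (p.1 - x₀, 0) (1 : ℝ) := by
      refine HasDerivAt.prodMk ?_ (hasDerivAt_const (1 : ℝ) p.2)
      simpa using ((hasDerivAt_id (1 : ℝ)).mul_const (p.1 - x₀)).const_add x₀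
    have h4 : HasFDerivAt y (fderiv ℝ y p) (m (1, p)) := by
      rw [hm1]
      exact (hdiff p hp).hasFDerivAt
    have h5 := (h4.comp_hasDerivAt (1 : ℝ) h3).hasDerivWithinAt (s := Set.Icc 0 1)
    have h6 := (uniqueDiffOn_Icc (zero_lt_one' ℝ) 1 (by simp)).eq_deriv _ h5 h1
    have h7 : (p.1 - x₀, (0 : Q)) = (p.1 - x₀) • ((1 : ℝ), (0 : Q)) := by simp
    rw [h7, map_smul] at h6
    rw [h6]
    have h8 : Set.projIcc (0 : ℝ) 1 zero_le_one 1 = 1 := by simp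
    simp only [f, h8]
    rw [hG p hp]
    simp only [h, Set.Icc.coe_one, hm1]
    rfl
  refine ⟨y, hy, fun p hp => ?_, fun t ht => ?_⟩
  -- On the slice `x = x₀` the factor cannot be cancelled; there the equation follows by continuity
  -- from nearby `x ≠ x₀`.
  · by_cases hpx : p.1 = x₀
    · obtain ⟨x, t⟩ := p
      obtain rfl : x = x₀ := hpx
      have hc1 : ContinuousAt (fun q => fderiv ℝ y q (1, 0)) (x, t) :=
        (((hy.fderiv_of_isOpen hS (m := 0) (by simp)).continuousOn.clm_apply
          continuousOn_const).continuousAt (hS.mem_nhds hp))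
      have hc2 : ContinuousAt (fun q => B q (y q)) (x, t) :=
        ((hB.continuousOn.clm_apply hy.continuousOn).continuousAt (hS.mem_nhds hp))
      have hl : Filter.Tendsto (fun s : ℝ => (s, t)) (nhdsWithin x {x}ᶜ) (nhds (x, t)) :=
        ((Continuous.prodMk_left t).tendsto x).mono_left nhdsWithin_le_nhds
      refine tendsto_nhds_unique (hc1.tendsto.comp hl) ((hc2.tendsto.comp hl).congr' ?_)
      have hev : ∀ᶠ s in nhdsWithin x {x}ᶜ, s ∈ I ∧ s ≠ x :=
        Filter.Eventually.and (nhdsWithin_le_nhds (hIo.mem_nhds hp.1)) self_mem_nhdsWithin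
      filter_upwards [hev] with s hs
      exact (smul_right_injective V (sub_ne_zero.2 hs.2) (hmul (s, t) ⟨hs.1, hp.2⟩)).symm
    · exact smul_right_injective V (sub_ne_zero.2 hpx) (hmul p hp)
  · have := hresc (x₀, t) ⟨hx₀, ht⟩ 0
    simp only [m, sub_self, mul_zero, add_zero] at this
    rw [this, volterraSol_apply, volterra_apply]
    simp

end ODE

/-- Linear systems with smooth coefficients on `I × U` have smooth solutions. -/
theorem exists_smoothFn_solution {r : ℕ} {I : Opens ℝ} (hI : (I : Set ℝ).OrdConnected)
    {U : Opens (Fin r → ℝ)} {κ : Type} [Fintype κ] (B : Matrix κ κ (smoothFn (domain I U)))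
    (z : domain I U) (c : κ → ℝ) :
    ∃ y : κ → smoothFn (domain I U),
      (∀ k, pderiv _ (y k) = ∑ l, B k l * y l) ∧ ∀ k, (y k).1 z = c k := by
  classical
  let L : (κ → κ → ℝ) →L[ℝ] (κ → ℝ) →L[ℝ] (κ → ℝ) :=
    LinearMap.toContinuousLinearMap
      ((LinearMap.toContinuousLinearMap : ((κ → ℝ) →ₗ[ℝ] (κ → ℝ)) ≃ₗ[ℝ] _).toLinearMap ∘ₗ
        (Matrix.toLin' : Matrix κ κ ℝ ≃ₗ[ℝ] _).toLinearMap ∘ₗ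
        (Matrix.ofLinearEquiv ℝ : (κ → κ → ℝ) ≃ₗ[ℝ] Matrix κ κ ℝ).toLinearMap)
  have hL (A : κ → κ → ℝ) (v : κ → ℝ) : L A v = (Matrix.of A).mulVec v := rfl
  let B' : ℝ × (Fin r → ℝ) → κ → κ → ℝ := fun p k l => ext (B k l).1 p
  have hB' : ContDiffOn ℝ ∞ (fun p => L (B' p)) ((I : Set ℝ) ×ˢ (U : Set (Fin r → ℝ))) := by
    refine L.contDiff.comp_contDiffOn ?_
    exact contDiffOn_pi.2 fun k => contDiffOn_pi.2 fun l => (B k l).2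
  obtain ⟨y, hy, hy', hyc⟩ := exists_contDiffOn_solution I.isOpen hI U.isOpen hB' z.2.1 c
  have hext (k : κ) : ∀ p ∈ (domain I U : Set (ℝ × (Fin r → ℝ))),
      ext (fun z : domain I U => y z.1 k) p = y p k := fun p hp => ext_of_mem _ hp
  refine ⟨fun k => ⟨fun z => y z.1 k, ((contDiffOn_pi.1 hy k).congr (hext k))⟩, fun k => ?_,
    fun k => congrFun (hyc z.1.2 z.2.2) k⟩
  apply Subtype.ext
  funext p
  have hsum : (∑ l, B k l * (⟨fun z => y z.1 l, ((contDiffOn_pi.1 hy l).congr (hext l))⟩ :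
      smoothFn (domain I U))).1 p = ∑ l, (B k l).1 p * y p.1 l := by
    simp
  rw [hsum]
  have hnh : (domain I U : Set (ℝ × (Fin r → ℝ))) ∈ nhds p.1 := (domain I U).isOpen.mem_nhds p.2
  change fderiv ℝ (ext fun z : domain I U => y z.1 k) p.1 (1, 0) = _
  have he : (ext fun z : domain I U => y z.1 k) =ᶠ[nhds p.1] fun q => y q k :=
    Filter.eventuallyEq_of_mem hnh (hext k)
  have hd : DifferentiableAt ℝ y p.1 := (hy.contDiffAt hnh).differentiableAt (by simp)
  rw [he.fderiv_eq]
  have h1 := congrFun (hy' p.1 p.2) k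
  rw [hL] at h1
  have h2 : fderiv ℝ (fun q => y q k) p.1 (1, 0) = fderiv ℝ y p.1 (1, 0) k := by
    rw [((hasFDerivAt_pi'.1 hd.hasFDerivAt) k).fderiv]
    rfl
  rw [h2, h1]
  simp [Matrix.mulVec, dotProduct, B', ext_of_mem _ p.2]

/-! ### The Grassmann algebra -/

section Grassmann

open CliffordAlgebra

variable {s : ℕ}

/-- The derivation `∂/∂θ_i` of the Grassmann algebra. -/
def grassmannDeriv (i : Fin (s + 1)) : Grassmann s →ₗ[ℝ] Grassmann s :=
  CliffordAlgebra.contractLeft (Q := (0 : QuadraticForm ℝ (Fin (s + 1) → ℝ))) (LinearMap.proj i)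

/-- The parity automorphism of the Grassmann algebra. -/
def grassmannInvolute (s : ℕ) : Grassmann s →ₐ[ℝ] Grassmann s :=
  CliffordAlgebra.involute (Q := (0 : QuadraticForm ℝ (Fin (s + 1) → ℝ)))

/-- The substitution of `0` for the generators with index in `T`. -/
def grassmannKill (T : Finset (Fin (s + 1))) : Grassmann s →ₐ[ℝ] Grassmann s :=
  ExteriorAlgebra.map (LinearMap.pi fun j => if j ∈ T then 0 else LinearMap.proj j)

/-- The generators of the Grassmann algebra. -/
def grassmannGen (i : Fin (s + 1)) : Grassmann s := ExteriorAlgebra.ι ℝ (Pi.single i 1)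

lemma grassmann_induction {C : Grassmann s → Prop} (h1 : ∀ r : ℝ, C (algebraMap ℝ _ r))
    (h2 : ∀ x y, C x → C y → C (x + y)) (h3 : ∀ v x, C x → C (ExteriorAlgebra.ι ℝ v * x))
    (x : Grassmann s) : C x :=
  CliffordAlgebra.left_induction _ h1 h2 (fun x v hx => h3 v x hx) x

lemma grassmann_hom_congr {A : Type*} [Ring A] [Algebra ℝ A] {f g : Grassmann s →ₐ[ℝ] A}
    (h : ∀ v, f (ExteriorAlgebra.ι ℝ v) = g (ExteriorAlgebra.ι ℝ v)) (x : Grassmann s) :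
    f x = g x := by
  induction x using grassmann_induction with
  | h1 r => rw [AlgHom.commutes, AlgHom.commutes]
  | h2 x y hx hy => rw [map_add, map_add, hx, hy]
  | h3 v x hx => rw [map_mul, map_mul, hx, h]

@[simp] lemma grassmannInvolute_ι (v : Fin (s + 1) → ℝ) :
    grassmannInvolute s (ExteriorAlgebra.ι ℝ v) = -ExteriorAlgebra.ι ℝ v :=
  CliffordAlgebra.involute_ι v

@[simp] lemma grassmannInvolute_gen (i : Fin (s + 1)) :
    grassmannInvolute s (grassmannGen i) = -grassmannGen i := grassmannInvolute_ι _

@[simp] lemma grassmannDeriv_algebraMap (i : Fin (s + 1)) (r : ℝ) :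
    grassmannDeriv i (algebraMap ℝ _ r) = 0 := CliffordAlgebra.contractLeft_algebraMap _ _ r

@[simp] lemma grassmannDeriv_one (i : Fin (s + 1)) :
    grassmannDeriv i 1 = 0 := CliffordAlgebra.contractLeft_one _ _

@[simp] lemma grassmannDeriv_grassmannDeriv (i : Fin (s + 1)) (x : Grassmann s) :
    grassmannDeriv i (grassmannDeriv i x) = 0 := CliffordAlgebra.contractLeft_contractLeft _ x

lemma grassmannDeriv_ι_mul (i : Fin (s + 1)) (v : Fin (s + 1) → ℝ) (x : Grassmann s) :
    grassmannDeriv i (ExteriorAlgebra.ι ℝ v * x) =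
      v i • x - ExteriorAlgebra.ι ℝ v * grassmannDeriv i x :=
  CliffordAlgebra.contractLeft_ι_mul _ _ x

@[simp] lemma grassmannDeriv_gen (i : Fin (s + 1)) : grassmannDeriv i (grassmannGen i) = 1 := by
  have := grassmannDeriv_ι_mul i (Pi.single i 1) 1
  simpa [grassmannGen] using this

@[simp] lemma grassmannGen_mul_self (i : Fin (s + 1)) : grassmannGen i * grassmannGen i = 0 :=
  ExteriorAlgebra.ι_sq_zero _

lemma grassmann_mul_ι (x : Grassmann s) (v : Fin (s + 1) → ℝ) :
    x * ExteriorAlgebra.ι ℝ v = ExteriorAlgebra.ι ℝ v * grassmannInvolute s x := by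
  induction x using grassmann_induction with
  | h1 r => simp [Algebra.commutes]
  | h2 x y hx hy => simp [add_mul, mul_add, hx, hy]
  | h3 w x hx =>
    have := eq_neg_of_add_eq_zero_left (ExteriorAlgebra.ι_add_mul_swap (R := ℝ) w v)
    rw [mul_assoc, hx, ← mul_assoc, this]
    simp [mul_assoc]

lemma grassmann_commute_of_involute_eq {x : Grassmann s} (hx : grassmannInvolute s x = x)
    (y : Grassmann s) : x * y = y * x := by
  induction y using grassmann_induction with
  | h1 r => exact (Algebra.commutes _ _).symm
  | h2 y z hy hz => rw [mul_add, add_mul, hy, hz]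
  | h3 v y hy => rw [← mul_assoc, grassmann_mul_ι, hx, mul_assoc, hy, mul_assoc]

lemma grassmannDeriv_mul (i : Fin (s + 1)) (x y : Grassmann s) :
    grassmannDeriv i (x * y) =
      grassmannDeriv i x * y + grassmannInvolute s x * grassmannDeriv i y := by
  induction x using grassmann_induction with
  | h1 r => simp [← Algebra.smul_def]
  | h2 x z hx hz =>
    simp only [add_mul, map_add, hx, hz]
    abel
  | h3 v x hx =>
    rw [mul_assoc, grassmannDeriv_ι_mul, hx, grassmannDeriv_ι_mul, map_mul, grassmannInvolute_ι]
    simp only [sub_mul, smul_mul_assoc, mul_add, neg_mul, mul_assoc]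
    abel

lemma grassmannInvolute_deriv (i : Fin (s + 1)) (x : Grassmann s) :
    grassmannInvolute s (grassmannDeriv i x) = -grassmannDeriv i (grassmannInvolute s x) := by
  induction x using grassmann_induction with
  | h1 r => simp
  | h2 x z hx hz => simp [hx, hz, add_comm]
  | h3 v x hx =>
    rw [grassmannDeriv_ι_mul, map_mul, grassmannInvolute_ι, neg_mul, map_neg,
      grassmannDeriv_ι_mul, map_sub, map_mul, hx]
    simp

lemma grassmannKill_ι (T : Finset (Fin (s + 1))) (v : Fin (s + 1) → ℝ) :
    grassmannKill T (ExteriorAlgebra.ι ℝ v) =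
      ExteriorAlgebra.ι ℝ fun j => if j ∈ T then 0 else v j := by
  rw [grassmannKill, ExteriorAlgebra.map_apply_ι]
  congr 1
  funext j
  by_cases hj : j ∈ T <;> simp [hj]

/-- The Taylor expansion in one odd variable, which stops after the linear term because the variable
squares to zero. -/
lemma grassmann_eq_kill_add (i : Fin (s + 1)) (x : Grassmann s) :
    x = grassmannKill {i} x + grassmannGen i * grassmannDeriv i x := by
  induction x using grassmann_induction with
  | h1 r => simp
  | h2 x z hx hz =>
    nth_rewrite 1 [hx, hz]
    simp only [map_add, mul_add]
    abel
  | h3 v x hx =>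
    have hv : (ExteriorAlgebra.ι ℝ fun j => if j ∈ ({i} : Finset _) then 0 else v j) =
        ExteriorAlgebra.ι ℝ v - v i • grassmannGen i := by
      rw [grassmannGen, ← map_smul, ← map_sub]
      congr 1
      funext j
      by_cases hj : j = i
      · subst hj; simp
      · simp [hj]
    have hanti := eq_neg_of_add_eq_zero_left
      (ExteriorAlgebra.ι_add_mul_swap (R := ℝ) v (Pi.single i (1 : ℝ)))
    rw [← grassmannGen] at hanti
    have h2 : grassmannGen i * grassmannKill {i} x = grassmannGen i * x := by
      conv_rhs => rw [hx, mul_add, ← mul_assoc, grassmannGen_mul_self, zero_mul, add_zero]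
    rw [map_mul, grassmannKill_ι, hv, grassmannDeriv_ι_mul, sub_mul, smul_mul_assoc, h2, mul_sub,
      mul_smul_comm, ← mul_assoc _ (ExteriorAlgebra.ι ℝ v), ← neg_eq_iff_eq_neg.2 hanti]
    nth_rewrite 1 [hx]
    rw [mul_add, neg_mul, mul_assoc]
    abel

lemma grassmannKill_insert (i : Fin (s + 1)) (T : Finset (Fin (s + 1))) (x : Grassmann s) :
    grassmannKill (insert i T) x = grassmannKill {i} (grassmannKill T x) := by
  refine grassmann_hom_congr (f := grassmannKill (insert i T))
    (g := (grassmannKill {i}).comp (grassmannKill T)) (fun v => ?_) x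
  simp only [AlgHom.comp_apply, grassmannKill_ι]
  congr 1
  funext j
  by_cases h1 : j = i <;> by_cases h2 : j ∈ T <;> simp [h1, h2]

lemma grassmannKill_empty (x : Grassmann s) : grassmannKill ∅ x = x := by
  refine grassmann_hom_congr (f := grassmannKill ∅) (g := AlgHom.id ℝ _) (fun v => ?_) x
  simp [grassmannKill_ι]

lemma grassmannKill_univ (x : Grassmann s) :
    grassmannKill Finset.univ x = algebraMap ℝ _ (ExteriorAlgebra.algebraMapInv x) := by
  refine grassmann_hom_congr (f := grassmannKill Finset.univ)
    (g := (Algebra.ofId ℝ _).comp ExteriorAlgebra.algebraMapInv) (fun v => ?_) x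
  have h0 : (ExteriorAlgebra.ι ℝ fun _ : Fin (s + 1) => (0 : ℝ)) = 0 := map_zero _
  simp [grassmannKill_ι, ExteriorAlgebra.algebraMapInv, h0]

lemma algebraMapInv_grassmannInvolute (x : Grassmann s) :
    ExteriorAlgebra.algebraMapInv (grassmannInvolute s x) = ExteriorAlgebra.algebraMapInv x := by
  refine grassmann_hom_congr (f := ExteriorAlgebra.algebraMapInv.comp (grassmannInvolute s))
    (g := ExteriorAlgebra.algebraMapInv) (fun v => ?_) x
  simp [ExteriorAlgebra.algebraMapInv]

lemma algebraMapInv_grassmannKill (T : Finset (Fin (s + 1))) (x : Grassmann s) :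
    ExteriorAlgebra.algebraMapInv (grassmannKill T x) = ExteriorAlgebra.algebraMapInv x := by
  refine grassmann_hom_congr (f := ExteriorAlgebra.algebraMapInv.comp (grassmannKill T))
    (g := ExteriorAlgebra.algebraMapInv) (fun v => ?_) x
  simp [ExteriorAlgebra.algebraMapInv, grassmannKill_ι]

lemma algebraMapInv_grassmannGen (i : Fin (s + 1)) :
    ExteriorAlgebra.algebraMapInv (grassmannGen i) = (0 : ℝ) := by
  simp [ExteriorAlgebra.algebraMapInv, grassmannGen]

end Grassmann

/-! ### The algebra of functions on the superline -/

section Functions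

variable {r : ℕ} {Ω : Opens (ℝ × (Fin r → ℝ))} {s : ℕ}

/-- The product of a smooth function and an element of the Grassmann algebra. -/
def stmul (f : smoothFn Ω) (g : Grassmann s) : SFun Ω s :=
  (f ⊗ₜ[ℝ] g : smoothFn Ω ⊗[ℝ] Grassmann s)

lemma SFun.induction {C : SFun Ω s → Prop} (h1 : ∀ f g, C (stmul f g))
    (h2 : ∀ x y, C x → C y → C (x + y)) (x : SFun Ω s) : C x := by
  refine TensorProduct.induction_on x ?_ h1 h2
  have := h1 0 0
  rwa [stmul, TensorProduct.zero_tmul] at this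

lemma stmul_add (f : smoothFn Ω) (g h : Grassmann s) :
    stmul f (g + h) = stmul f g + stmul f h := TensorProduct.tmul_add _ _ _

lemma add_stmul (f g : smoothFn Ω) (h : Grassmann s) :
    stmul (f + g) h = stmul f h + stmul g h := TensorProduct.add_tmul _ _ _

lemma stmul_neg (f : smoothFn Ω) (g : Grassmann s) :
    stmul f (-g) = -stmul f g := TensorProduct.tmul_neg _ _

@[simp] lemma stmul_zero (f : smoothFn Ω) : stmul f (0 : Grassmann s) = 0 :=
  TensorProduct.tmul_zero _ _

@[simp] lemma zero_stmul (g : Grassmann s) : stmul (0 : smoothFn Ω) g = 0 :=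
  TensorProduct.zero_tmul _ _

lemma stmul_mul_stmul (f g : smoothFn Ω) (x y : Grassmann s) :
    stmul f x * stmul g y = stmul (f * g) (x * y) :=
  Algebra.TensorProduct.tmul_mul_tmul _ _ _ _

lemma one_eq_stmul : (1 : SFun Ω s) = stmul 1 1 := Algebra.TensorProduct.one_def

lemma stmul_algebraMap (f : smoothFn Ω) (c : ℝ) :
    stmul f (algebraMap ℝ (Grassmann s) c) = stmul (c • f) 1 := by
  rw [Algebra.algebraMap_eq_smul_one]
  exact TensorProduct.tmul_smul c f 1 |>.trans (TensorProduct.smul_tmul' c f 1)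

variable (Ω s) in
/-- The parity automorphism. -/
def sigma : SFun Ω s →ₐ[ℝ] SFun Ω s :=
  (Algebra.TensorProduct.map (AlgHom.id ℝ (smoothFn Ω)) (grassmannInvolute s) :
    smoothFn Ω ⊗[ℝ] Grassmann s →ₐ[ℝ] smoothFn Ω ⊗[ℝ] Grassmann s)

variable (Ω) in
/-- The substitution of `0` for the odd variables with index in `T`. -/
def kill (T : Finset (Fin (s + 1))) : SFun Ω s →ₐ[ℝ] SFun Ω s :=
  (Algebra.TensorProduct.map (AlgHom.id ℝ (smoothFn Ω)) (grassmannKill T) :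
    smoothFn Ω ⊗[ℝ] Grassmann s →ₐ[ℝ] smoothFn Ω ⊗[ℝ] Grassmann s)

variable (Ω s) in
/-- The body: the value at `0` of the odd variables. -/
def body : SFun Ω s →ₐ[ℝ] smoothFn Ω :=
  ((Algebra.TensorProduct.rid ℝ ℝ (smoothFn Ω)).toAlgHom.comp
    (Algebra.TensorProduct.map (AlgHom.id ℝ (smoothFn Ω)) ExteriorAlgebra.algebraMapInv) :
      smoothFn Ω ⊗[ℝ] Grassmann s →ₐ[ℝ] smoothFn Ω)

variable (Ω) in
/-- The odd variables. -/
def gen (i : Fin (s + 1)) : SFun Ω s := stmul 1 (grassmannGen i)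

variable (Ω) in
/-- The derivative in an odd variable. -/
def dgen (i : Fin (s + 1)) : Module.End ℝ (SFun Ω s) :=
  LinearMap.lTensor (smoothFn Ω) (grassmannDeriv i)

lemma sigma_stmul (f : smoothFn Ω) (g : Grassmann s) :
    sigma Ω s (stmul f g) = stmul f (grassmannInvolute s g) := rfl

lemma kill_stmul (T : Finset (Fin (s + 1))) (f : smoothFn Ω) (g : Grassmann s) :
    kill Ω T (stmul f g) = stmul f (grassmannKill T g) := rfl

lemma body_stmul (f : smoothFn Ω) (g : Grassmann s) :
    body Ω s (stmul f g) = (ExteriorAlgebra.algebraMapInv g : ℝ) • f := rfl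

lemma dgen_stmul (i : Fin (s + 1)) (f : smoothFn Ω) (g : Grassmann s) :
    dgen Ω i (stmul f g) = stmul f (grassmannDeriv i g) := rfl

lemma dx_stmul (f : smoothFn Ω) (g : Grassmann s) :
    dx Ω s (stmul f g) = stmul (pderiv Ω f) g := rfl

@[simp] lemma sigma_gen (i : Fin (s + 1)) : sigma Ω s (gen Ω i) = -gen Ω i := by
  rw [gen, sigma_stmul, grassmannInvolute_gen, stmul_neg]

@[simp] lemma gen_mul_self (i : Fin (s + 1)) : gen Ω i * gen Ω i = 0 := by
  simp [gen, stmul_mul_stmul]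

@[simp] lemma dgen_gen (i : Fin (s + 1)) : dgen Ω i (gen Ω i) = 1 := by
  rw [gen, dgen_stmul, grassmannDeriv_gen, one_eq_stmul]

@[simp] lemma body_gen (i : Fin (s + 1)) : body Ω s (gen Ω i) = 0 := by
  rw [gen, body_stmul, algebraMapInv_grassmannGen, zero_smul]

lemma mul_gen (x : SFun Ω s) (i : Fin (s + 1)) : x * gen Ω i = gen Ω i * sigma Ω s x := by
  induction x using SFun.induction with
  | h1 f g => simp [gen, stmul_mul_stmul, sigma_stmul, grassmannGen, grassmann_mul_ι]
  | h2 x y hx hy => simp [add_mul, mul_add, hx, hy]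

@[simp] lemma dgen_dgen (i : Fin (s + 1)) (x : SFun Ω s) : dgen Ω i (dgen Ω i x) = 0 := by
  induction x using SFun.induction with
  | h1 f g => simp [dgen_stmul]
  | h2 x y hx hy => simp [hx, hy]

lemma dgen_mul (i : Fin (s + 1)) (x y : SFun Ω s) :
    dgen Ω i (x * y) = dgen Ω i x * y + sigma Ω s x * dgen Ω i y := by
  induction x using SFun.induction with
  | h1 f g =>
    induction y using SFun.induction with
    | h1 f' g' =>
      simp only [stmul_mul_stmul, dgen_stmul, sigma_stmul, grassmannDeriv_mul, stmul_add]
    | h2 x y hx hy =>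
      simp only [mul_add, map_add, hx, hy]
      abel
  | h2 x z hx hy =>
    simp only [add_mul, map_add, hx, hy]
    abel

lemma sigma_dgen (i : Fin (s + 1)) (x : SFun Ω s) :
    sigma Ω s (dgen Ω i x) = -dgen Ω i (sigma Ω s x) := by
  induction x using SFun.induction with
  | h1 f g => simp only [dgen_stmul, sigma_stmul, grassmannInvolute_deriv, stmul_neg]
  | h2 x y hx hy => simp [hx, hy, add_comm]

lemma eq_kill_add (i : Fin (s + 1)) (x : SFun Ω s) :
    x = kill Ω {i} x + gen Ω i * dgen Ω i x := by
  induction x using SFun.induction with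
  | h1 f g =>
    rw [kill_stmul, dgen_stmul, gen, stmul_mul_stmul, one_mul, ← stmul_add,
      ← grassmann_eq_kill_add]
  | h2 x y hx hy =>
    nth_rewrite 1 [hx, hy]
    simp only [map_add, mul_add]
    abel

lemma kill_insert (i : Fin (s + 1)) (T : Finset (Fin (s + 1))) (x : SFun Ω s) :
    kill Ω (insert i T) x = kill Ω {i} (kill Ω T x) := by
  induction x using SFun.induction with
  | h1 f g => simp only [kill_stmul, grassmannKill_insert]
  | h2 x y hx hy => simp [hx, hy]

lemma kill_empty (x : SFun Ω s) : kill Ω ∅ x = x := by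
  induction x using SFun.induction with
  | h1 f g => simp only [kill_stmul, grassmannKill_empty]
  | h2 x y hx hy => simp [hx, hy]

lemma kill_univ (x : SFun Ω s) : kill Ω Finset.univ x = stmul (body Ω s x) 1 := by
  induction x using SFun.induction with
  | h1 f g => rw [kill_stmul, grassmannKill_univ, stmul_algebraMap, body_stmul]
  | h2 x y hx hy => simp [hx, hy, add_stmul]

@[simp] lemma body_sigma (x : SFun Ω s) : body Ω s (sigma Ω s x) = body Ω s x := by
  induction x using SFun.induction with
  | h1 f g => simp only [sigma_stmul, body_stmul, algebraMapInv_grassmannInvolute]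
  | h2 x y hx hy => simp [hx, hy]

@[simp] lemma body_kill (T : Finset (Fin (s + 1))) (x : SFun Ω s) :
    body Ω s (kill Ω T x) = body Ω s x := by
  induction x using SFun.induction with
  | h1 f g => simp only [kill_stmul, body_stmul, algebraMapInv_grassmannKill]
  | h2 x y hx hy => simp [hx, hy]

lemma body_eq_zero_of_sigma_eq_neg {x : SFun Ω s} (hx : sigma Ω s x = -x) :
    body Ω s x = 0 := by
  have := body_sigma x
  rw [hx, map_neg] at this
  calc body Ω s x = (2⁻¹ : ℝ) • (body Ω s x + body Ω s x) := by
        rw [← two_smul ℝ, smul_smul]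
        norm_num
    _ = 0 := by
        nth_rewrite 1 [← this]
        rw [neg_add_cancel, smul_zero]

variable (Ω s) in
/-- The projection onto the even elements, by averaging over the parity automorphism. -/
def evenPart : SFun Ω s →ₗ[ℝ] SFun Ω s := (2⁻¹ : ℝ) • (LinearMap.id + (sigma Ω s).toLinearMap)

/-- Being fixed by `sigma` is not a condition on pure tensors. The averaging projection is linear,
so the claim reduces to pure tensors, where the Grassmann factor becomes even. -/
lemma commute_evenPart (x y : SFun Ω s) : evenPart Ω s x * y = y * evenPart Ω s x := by
  induction x using SFun.induction with
  | h1 f g =>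
    induction y using SFun.induction with
    | h1 f' g' =>
      have hg : grassmannInvolute s (g + grassmannInvolute s g) = g + grassmannInvolute s g := by
        rw [map_add, add_comm]
        congr 1
        exact CliffordAlgebra.involute_involute g
      have h1 : evenPart Ω s (stmul f g) =
          (2⁻¹ : ℝ) • stmul f (g + grassmannInvolute s g) := by
        rw [stmul_add, ← sigma_stmul]
        rfl
      rw [h1, smul_mul_assoc, mul_smul_comm, stmul_mul_stmul, stmul_mul_stmul, mul_comm f,
        grassmann_commute_of_involute_eq hg]
    | h2 x y hx hy => rw [mul_add, add_mul, hx, hy]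
  | h2 x z hx hz => rw [map_add, mul_add, add_mul, hx, hz]

/-- Even elements are central. -/
lemma commute_of_sigma_eq {x : SFun Ω s} (hx : sigma Ω s x = x) (y : SFun Ω s) :
    x * y = y * x := by
  have h : evenPart Ω s x = x := by
    change (2⁻¹ : ℝ) • (x + sigma Ω s x) = x
    rw [hx, ← two_smul ℝ, smul_smul]
    norm_num
  rw [← h, commute_evenPart]

lemma sigma_eq_of_mem_parity_zero {x : SFun Ω s} (hx : x ∈ parity Ω s 0) :
    sigma Ω s x = x := by
  obtain ⟨y, rfl⟩ := hx
  have h : (grassmannInvolute s).toLinearMap ∘ₗ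
      (CliffordAlgebra.evenOdd (0 : QuadraticForm ℝ (Fin (s + 1) → ℝ)) 0).subtype =
        (CliffordAlgebra.evenOdd (0 : QuadraticForm ℝ (Fin (s + 1) → ℝ)) 0).subtype :=
    LinearMap.ext fun g => CliffordAlgebra.involute_eq_of_mem_even g.2
  have h2 := congrArg (LinearMap.lTensor (smoothFn Ω)) h
  rw [LinearMap.lTensor_comp] at h2
  exact LinearMap.congr_fun h2 y

lemma sigma_eq_of_mem_parity_one {x : SFun Ω s} (hx : x ∈ parity Ω s 1) :
    sigma Ω s x = -x := by
  obtain ⟨y, rfl⟩ := hx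
  have h : (grassmannInvolute s).toLinearMap ∘ₗ
      (CliffordAlgebra.evenOdd (0 : QuadraticForm ℝ (Fin (s + 1) → ℝ)) 1).subtype =
        -(CliffordAlgebra.evenOdd (0 : QuadraticForm ℝ (Fin (s + 1) → ℝ)) 1).subtype :=
    LinearMap.ext fun g => CliffordAlgebra.involute_eq_of_mem_odd g.2
  have h2 := congrArg (LinearMap.lTensor (smoothFn Ω)) h
  rw [LinearMap.lTensor_comp, LinearMap.lTensor_neg] at h2
  exact LinearMap.congr_fun h2 y

lemma pderiv_mul (f g : smoothFn Ω) :
    pderiv Ω (f * g) = pderiv Ω f * g + f * pderiv Ω g := by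
  apply Subtype.ext
  funext z
  have h : ext (f * g : smoothFn Ω).1 = ext f.1 * ext g.1 := by
    funext w
    by_cases hw : w ∈ Ω <;> simp [ext, hw]
  change fderiv ℝ (ext (f * g : smoothFn Ω).1) z.1 (1, 0) = _
  rw [h, fderiv_mul (differentiableAt_ext f.2 z) (differentiableAt_ext g.2 z)]
  simp [ext_of_mem _ z.2, pderiv, pderivFun]
  ring

lemma dx_mul (x y : SFun Ω s) : dx Ω s (x * y) = dx Ω s x * y + x * dx Ω s y := by
  induction x using SFun.induction with
  | h1 f g =>
    induction y using SFun.induction with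
    | h1 f' g' => simp only [stmul_mul_stmul, dx_stmul, pderiv_mul, add_stmul]
    | h2 x y hx hy =>
      simp only [mul_add, map_add, hx, hy]
      abel
  | h2 x z hx hy =>
    simp only [add_mul, map_add, hx, hy]
    abel

@[simp] lemma dx_gen (i : Fin (s + 1)) : dx Ω s (gen Ω i) = 0 := by
  have h : pderiv Ω 1 = 0 := by
    have := pderiv_mul (1 : smoothFn Ω) 1
    rw [mul_one, mul_one, one_mul] at this
    exact left_eq_add.1 this
  rw [gen, dx_stmul, h, zero_stmul]

lemma dx_sigma (x : SFun Ω s) : dx Ω s (sigma Ω s x) = sigma Ω s (dx Ω s x) := by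
  induction x using SFun.induction with
  | h1 f g => rfl
  | h2 x y hx hy => simp [hx, hy]

lemma dx_kill (T : Finset (Fin (s + 1))) (x : SFun Ω s) :
    dx Ω s (kill Ω T x) = kill Ω T (dx Ω s x) := by
  induction x using SFun.induction with
  | h1 f g => rfl
  | h2 x y hx hy => simp [hx, hy]

lemma dx_dgen (i : Fin (s + 1)) (x : SFun Ω s) :
    dx Ω s (dgen Ω i x) = dgen Ω i (dx Ω s x) := by
  induction x using SFun.induction with
  | h1 f g => rfl
  | h2 x y hx hy => simp [hx, hy]

lemma dgen_kill (i : Fin (s + 1)) (x : SFun Ω s) : dgen Ω i (kill Ω {i} x) = 0 := by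
  have h := congrArg (dgen Ω i) (eq_kill_add i x)
  rw [map_add, dgen_mul, dgen_gen, dgen_dgen, one_mul, mul_zero, add_zero] at h
  exact left_eq_add.1 (h.trans (add_comm _ _))

@[simp] lemma kill_gen (i : Fin (s + 1)) : kill Ω {i} (gen Ω i) = 0 := by
  have h := eq_kill_add i (gen Ω i)
  rw [dgen_gen, mul_one] at h
  exact right_eq_add.1 h

@[simp] lemma kill_kill (i : Fin (s + 1)) (x : SFun Ω s) :
    kill Ω {i} (kill Ω {i} x) = kill Ω {i} x := by
  conv_rhs => rw [eq_kill_add i (kill Ω {i} x), dgen_kill, mul_zero, add_zero]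

/-- Both Taylor coefficients vanish: `dgen Ω i x` does not involve the `i`-th variable, so it equals
its value at zero of that variable. -/
lemma eq_zero_of_kill_eq_zero {i : Fin (s + 1)} {x : SFun Ω s} (h1 : kill Ω {i} x = 0)
    (h2 : kill Ω {i} (dgen Ω i x) = 0) : x = 0 := by
  have h3 := eq_kill_add i (dgen Ω i x)
  rw [h2, dgen_dgen, mul_zero, add_zero] at h3
  rw [eq_kill_add i x, h1, h3, mul_zero, add_zero]

lemma D_apply (x : SFun Ω s) : D Ω s x = dgen Ω 0 x + gen Ω 0 * dx Ω s x := rfl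

/-- The superderivative is an odd derivation. -/
lemma D_mul (x y : SFun Ω s) : D Ω s (x * y) = D Ω s x * y + sigma Ω s x * D Ω s y := by
  have h : gen Ω 0 * x = sigma Ω s x * gen Ω 0 := by
    rw [mul_gen]
    congr 1
    induction x using SFun.induction with
    | h1 f g => exact congrArg (stmul f) (CliffordAlgebra.involute_involute g).symm
    | h2 x y hx hy => rw [map_add, map_add, ← hx, ← hy]
  simp only [D_apply, dgen_mul, dx_mul, mul_add, add_mul]
  rw [← mul_assoc, ← mul_assoc, ← mul_assoc, h]
  abel

lemma D_D (x : SFun Ω s) : D Ω s (D Ω s x) = dx Ω s x := by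
  simp only [D_apply, map_add, dgen_dgen, dgen_mul, dgen_gen, dx_mul, dx_gen, sigma_gen,
    dx_dgen, mul_add, zero_mul, ← mul_assoc, gen_mul_self]
  simp

lemma sigma_D (x : SFun Ω s) : sigma Ω s (D Ω s x) = -D Ω s (sigma Ω s x) := by
  simp only [D_apply, map_add, map_mul, sigma_dgen, sigma_gen, dx_sigma, neg_mul, neg_add]

lemma sigma_D_pow (i : ℕ) (x : SFun Ω s) :
    sigma Ω s ((D Ω s ^ i) x) = (-1) ^ i * (D Ω s ^ i) (sigma Ω s x) := by
  induction i with
  | zero => simp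
  | succ i ih =>
    rw [pow_succ', Module.End.mul_apply, sigma_D, ih, pow_succ', Module.End.mul_apply]
    rcases neg_one_pow_eq_or (SFun Ω s) i with h | h <;> simp [h]

lemma D_of_isConst {c : SFun Ω s} (hc : IsConst c) : D Ω s c = 0 := by
  have h1 : dgen Ω 0 c = 0 := hc.2
  rw [D_apply, hc.1, h1, mul_zero, add_zero]

/-- Constants stand on the right, so the odd derivation passes them without a sign. -/
lemma D_pow_mul_const {c : SFun Ω s} (hc : IsConst c) (i : ℕ) (x : SFun Ω s) :
    (D Ω s ^ i) (x * c) = (D Ω s ^ i) x * c := by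
  induction i with
  | zero => rfl
  | succ i ih =>
    rw [pow_succ', Module.End.mul_apply, ih, D_mul, D_of_isConst hc, mul_zero, add_zero]
    rfl

end Functions

/-! ### Invertibility of matrices over the algebra of functions -/

section Units

variable {r : ℕ} {Ω : Opens (ℝ × (Fin r → ℝ))} {s : ℕ} {m : Type*} [Fintype m] [DecidableEq m]

/-- `X` differs from an invertible matrix by a left multiple of `T`, the odd variable times the
identity. Moving `T` through a matrix only applies `sigma` to the entries, so products with two
factors `T` vanish and the correction is nilpotent. -/
lemma isUnit_of_isUnit_map_kill_singleton {X : Matrix m m (SFun Ω s)} {i : Fin (s + 1)}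
    (h : IsUnit (X.map (kill Ω {i}))) : IsUnit X := by
  obtain ⟨u, hu⟩ := h
  let T : Matrix m m (SFun Ω s) := Matrix.diagonal fun _ => gen Ω i
  have hT (Z : Matrix m m (SFun Ω s)) : Z * T = T * Z.map (sigma Ω s) := by
    ext j k
    simp [T, Matrix.mul_diagonal, Matrix.diagonal_mul, mul_gen]
  have hTT : T * T = 0 := by
    simp [T]
  have hX : X = u + T * X.map (dgen Ω i) := by
    ext j k
    rw [hu]
    simpa [T, Matrix.diagonal_mul] using eq_kill_add i (X j k)
  let N : Matrix m m (SFun Ω s) := (↑u⁻¹ : Matrix m m (SFun Ω s)) * (T * X.map (dgen Ω i))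
  have hN : N * N = 0 := by
    have h1 : N = T * ((↑u⁻¹ : Matrix m m (SFun Ω s)).map (sigma Ω s) * X.map (dgen Ω i)) := by
      rw [← mul_assoc, ← hT, mul_assoc]
    have h2 (Z : Matrix m m (SFun Ω s)) : (T * Z) * (T * Z) = 0 := by
      rw [mul_assoc, ← mul_assoc Z, hT, mul_assoc, ← mul_assoc, hTT, zero_mul]
    rw [h1, h2]
  have hXu : X = u * (1 + N) := by
    rw [mul_add, mul_one, Units.mul_inv_cancel_left]
    exact hX
  rw [hXu]
  refine u.isUnit.mul (IsNilpotent.isUnit_one_add ⟨2, ?_⟩)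
  rw [pow_two, hN]

lemma isUnit_of_isUnit_map_kill {X : Matrix m m (SFun Ω s)} (T : Finset (Fin (s + 1)))
    (h : IsUnit (X.map (kill Ω T))) : IsUnit X := by
  induction T using Finset.induction_on with
  | empty =>
    have : X.map (kill Ω ∅) = X := by
      ext j k
      exact kill_empty _
    rwa [this] at h
  | insert i T _ ih =>
    refine ih (isUnit_of_isUnit_map_kill_singleton (i := i) ?_)
    have : (X.map (kill Ω T)).map (kill Ω {i}) = X.map (kill Ω (insert i T)) := by
      ext j k
      exact (kill_insert i T _).symm
    rwa [this]

lemma isUnit_of_isUnit_map_body {X : Matrix m m (SFun Ω s)} (h : IsUnit (X.map (body Ω s))) :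
    IsUnit X := by
  refine isUnit_of_isUnit_map_kill Finset.univ ?_
  let incl : smoothFn Ω →+* SFun Ω s :=
    { toFun := fun f => stmul f 1
      map_one' := one_eq_stmul.symm
      map_mul' := fun f g => by rw [stmul_mul_stmul, one_mul]
      map_zero' := zero_stmul _
      map_add' := fun f g => add_stmul f g _ }
  have := h.map incl.mapMatrix
  convert this using 1
  ext j k
  exact kill_univ _

lemma isUnit_smoothFn {f : smoothFn Ω} (hf : ∀ z, f.1 z ≠ 0) : IsUnit f := by
  have hg : (fun z => (f.1 z)⁻¹) ∈ smoothFn Ω := by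
    refine (ContDiffOn.inv (f := ext f.1) f.2 fun z hz => ?_).congr fun z hz => ?_
    · rw [ext_of_mem _ hz]
      exact hf _
    · have hz' : z ∈ Ω := hz
      simp [ext_of_mem _ hz']
  refine IsUnit.of_mul_eq_one ⟨_, hg⟩ (Subtype.ext ?_)
  funext z
  exact mul_inv_cancel₀ (hf z)

/-- The value of the body at a point. -/
def bodyAt (s : ℕ) (z : Ω) : SFun Ω s →+* ℝ :=
  ((Pi.evalRingHom (fun _ : Ω => ℝ) z).comp (smoothFn Ω).val.toRingHom).comp (body Ω s).toRingHom

lemma bodyAt_apply (z : Ω) (x : SFun Ω s) : bodyAt s z x = (body Ω s x).1 z := rfl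

/-- A matrix of functions is invertible if its body is invertible at every point. -/
theorem isUnit_of_forall_isUnit_bodyAt {X : Matrix m m (SFun Ω s)}
    (h : ∀ z, IsUnit (X.map (bodyAt s z))) : IsUnit X := by
  refine isUnit_of_isUnit_map_body ((Matrix.isUnit_iff_isUnit_det _).2 (isUnit_smoothFn fun z => ?_))
  have h1 := ((Matrix.isUnit_iff_isUnit_det _).1 (h z)).ne_zero
  have h2 : (X.map (body Ω s)).det.1 z = (X.map (bodyAt s z)).det :=
    RingHom.map_det ((Pi.evalRingHom (fun _ : Ω => ℝ) z).comp (smoothFn Ω).val.toRingHom)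
      (X.map (body Ω s))
  rwa [h2]

theorem isUnit_of_forall_bodyAt_ne_zero {x : SFun Ω s} (h : ∀ z, bodyAt s z x ≠ 0) :
    IsUnit x := by
  -- A scalar is treated as a matrix of size one.
  have h1 : IsUnit (Matrix.of fun _ _ : Unit => x) := by
    refine isUnit_of_forall_isUnit_bodyAt fun z => (Matrix.isUnit_iff_isUnit_det _).2 ?_
    simpa using h z
  obtain ⟨u, hu⟩ := h1
  have h2 := congrFun (congrFun u.mul_inv ()) ()
  have h3 := congrFun (congrFun u.inv_mul ()) ()
  rw [hu] at h2 h3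
  simp only [Matrix.mul_apply, Finset.univ_unique, Finset.sum_singleton, Matrix.of_apply,
    Matrix.one_apply_eq] at h2 h3
  exact ⟨⟨x, _, h2, h3⟩, rfl⟩

end Units

/-! ### Leibniz determinants and Cramer's rule for Berezinians -/

section Determinants

variable {R : Type*} [Ring R] {ι : Type*} [Fintype ι] [LinearOrder ι]

lemma ldet_map {S : Type*} [Ring S] (f : R →+* S) (A : Matrix ι ι R) :
    ldet (A.map f) = f (ldet A) := by
  simp [ldet, map_sum, map_list_prod, Function.comp_def]

lemma ldet_eq_det {S : Type*} [CommRing S] (A : Matrix ι ι S) : ldet A = A.det := by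
  rw [← Matrix.det_transpose, Matrix.det_apply, ldet]
  refine Finset.sum_congr rfl fun σ _ => ?_
  have : ((Finset.univ.sort (fun i j : ι => i ≤ j)).map fun i => A i (σ i)).prod =
      ∏ i, A i (σ i) := by
    rw [← List.prod_toFinset _ (Finset.sort_nodup _ _), Finset.sort_toFinset]
  rw [this]
  rfl

/-- A matrix with central entries, over the center. -/
def centralLift (A : Matrix ι ι R) (hA : ∀ i j, A i j ∈ Subring.center R) :
    Matrix ι ι (Subring.center R) := Matrix.of fun i j => ⟨A i j, hA i j⟩

omit [Fintype ι] [LinearOrder ι] in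
lemma centralLift_map (A : Matrix ι ι R) (hA : ∀ i j, A i j ∈ Subring.center R) :
    (centralLift A hA).map (Subring.center R).subtype = A := rfl

lemma ldet_eq_coe_det (A : Matrix ι ι R) (hA : ∀ i j, A i j ∈ Subring.center R) :
    ldet A = ((centralLift A hA).det : R) := by
  conv_lhs => rw [← centralLift_map A hA, ldet_map, ldet_eq_det]
  rfl

lemma ldet_mem_center {A : Matrix ι ι R} (hA : ∀ i j, A i j ∈ Subring.center R) :
    ldet A ∈ Subring.center R := by
  rw [ldet_eq_coe_det A hA]
  exact Subtype.property _

lemma ldet_eq_zero_of_row_eq {A : Matrix ι ι R} (hA : ∀ i j, A i j ∈ Subring.center R)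
    {i j : ι} (hij : i ≠ j) (h : A i = A j) : ldet A = 0 := by
  rw [ldet_eq_coe_det A hA, Matrix.det_zero_of_row_eq hij, ZeroMemClass.coe_zero]
  funext k
  exact Subtype.ext (congrFun h k)

/-- If the other rows have central entries, the determinant is a left linear function of one
row. -/
lemma exists_ldet_updateRow {A : Matrix ι ι R} (hA : ∀ i j, A i j ∈ Subring.center R) (i : ι) :
    ∃ P : Equiv.Perm ι → R, ∀ v : ι → R,
      ldet (A.updateRow i v) = ∑ σ, v (σ i) * P σ := by
  obtain ⟨l₁, l₂, hl⟩ := List.append_of_mem ((Finset.mem_sort (fun i j : ι => i ≤ j)).2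
    (Finset.mem_univ i))
  have hnd := Finset.sort_nodup (Finset.univ : Finset ι) (fun i j : ι => i ≤ j)
  rw [hl, List.nodup_middle, List.nodup_cons, List.mem_append, not_or] at hnd
  -- The factors from the rows before `i` are central, so the entry of `v` can be brought to the
  -- left end of each product.
  refine ⟨fun σ => ((Equiv.Perm.sign σ : ℤˣ) : ℤ) •
    ((l₁.map fun k => A k (σ k)).prod * (l₂.map fun k => A k (σ k)).prod), fun v => ?_⟩
  rw [ldet]
  refine Finset.sum_congr rfl fun σ _ => ?_
  have hmap (l : List ι) (hi : i ∉ l) :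
      (l.map fun k => A.updateRow i v k (σ k)) = l.map fun k => A k (σ k) := by
    refine List.map_congr_left fun k hk => ?_
    rw [Matrix.updateRow_ne]
    rintro rfl
    exact hi hk
  have hc : (l₁.map fun k => A k (σ k)).prod ∈ Subring.center R :=
    Subring.list_prod_mem _ fun x hx => by
      obtain ⟨k, _, rfl⟩ := List.mem_map.1 hx
      exact hA _ _
  rw [hl, List.map_append, List.map_cons, List.prod_append, List.prod_cons, hmap _ hnd.1.1,
    hmap _ hnd.1.2, Matrix.updateRow_self, mul_smul_comm, ← mul_assoc, ← mul_assoc,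
    (Subring.mem_center_iff.1 hc (v (σ i)))]

/-- By left linearity in the row, the coefficients come out on the left. A term with `l ≠ i` is the
determinant of a matrix with central entries and two equal rows. -/
lemma ldet_updateRow_sum {A : Matrix ι ι R} (hA : ∀ i j, A i j ∈ Subring.center R) (i : ι)
    (a : ι → R) : ldet (A.updateRow i fun j => ∑ l, a l * A l j) = a i * ldet A := by
  obtain ⟨P, hP⟩ := exists_ldet_updateRow hA i
  have h1 : ldet (A.updateRow i fun j => ∑ l, a l * A l j) =
      ∑ l, a l * ldet (A.updateRow i (A l)) := by
    simp only [hP, Finset.mul_sum, Finset.sum_mul]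
    rw [Finset.sum_comm]
    simp only [mul_assoc]
  rw [h1, Finset.sum_eq_single i]
  · rw [Matrix.updateRow_eq_self]
  · intro l _ hl
    rw [ldet_eq_zero_of_row_eq (i := l) (j := i) _ hl, mul_zero]
    · rw [Matrix.updateRow_self, Matrix.updateRow_ne hl]
    · intro j k
      by_cases hj : j = i
      · subst hj
        rw [Matrix.updateRow_self]
        exact hA _ _
      · rw [Matrix.updateRow_ne hj]
        exact hA _ _
  · simp

/-- The Schur complement of the odd-odd block. -/
def schur (p : ι → ZMod 2) (A : Matrix ι ι R) : Matrix {i // p i = 0} {i // p i = 0} R :=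
  A.toBlock (fun i => p i = 0) (fun i => p i = 0) -
      A.toBlock (fun i => p i = 0) (fun i => p i = 1) *
        Ring.inverse (A.toBlock (fun i => p i = 1) (fun i => p i = 1)) *
        A.toBlock (fun i => p i = 1) (fun i => p i = 0)

lemma Ber_eq (p : ι → ZMod 2) (A : Matrix ι ι R) :
    Ber p A = ldet (schur p A) *
      Ring.inverse (ldet (A.toBlock (fun i => p i = 1) (fun i => p i = 1))) := rfl

omit [Ring R] [Fintype ι] [LinearOrder ι] in
lemma toBlock_updateRow_of_ne [DecidableEq ι] {p q : ι → Prop} (A : Matrix ι ι R) {i : ι}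
    (hi : ¬ p i) (v : ι → R) : (A.updateRow i v).toBlock p q = A.toBlock p q := by
  ext j k
  have : (j : ι) ≠ i := by
    rintro h
    exact hi (h ▸ j.2)
  simp [Matrix.toBlock_apply, Matrix.updateRow_ne this]

/-- The matrix `A₁₁⁻¹ A₁₀`. -/
def oddSolve (p : ι → ZMod 2) (A : Matrix ι ι R) : Matrix {i // p i = 1} {i // p i = 0} R :=
  Ring.inverse (A.toBlock (fun i => p i = 1) (fun i => p i = 1)) *
    A.toBlock (fun i => p i = 1) (fun i => p i = 0)

lemma schur_apply (p : ι → ZMod 2) (A : Matrix ι ι R) (l j : {i // p i = 0}) :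
    schur p A l j = A l j - ∑ k : {i // p i = 1}, A l k * oddSolve p A k j := by
  rw [schur, Matrix.mul_assoc]
  rfl

/-- Says that an odd row becomes zero in the even columns once the odd columns have been eliminated.
-/
lemma sum_oddSolve {p : ι → ZMod 2} {A : Matrix ι ι R} (hU : BerDefined p A) {l : ι}
    (hl : p l = 1) (j : {i // p i = 0}) :
    ∑ k : {i // p i = 1}, A l k * oddSolve p A k j = A l j := by
  have h1 : A.toBlock (fun i => p i = 1) (fun i => p i = 1) * oddSolve p A =
      A.toBlock (fun i => p i = 1) (fun i => p i = 0) := by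
    rw [oddSolve, ← Matrix.mul_assoc, Ring.mul_inverse_cancel _ hU, Matrix.one_mul]
  have h2 := congrFun (congrFun h1 ⟨l, hl⟩) j
  rwa [Matrix.mul_apply] at h2

/-- The changed row is even, so `A₁₁` and `A₁₀` are untouched and elimination is a fixed operation,
linear from the left, on each row. It sends odd rows to zero, so only the even rows remain in the
combination. -/
lemma schur_updateRow_sum {p : ι → ZMod 2} {A : Matrix ι ι R} (hU : BerDefined p A) {i : ι}
    (hi : p i = 0) (a : ι → R) :
    schur p (A.updateRow i fun j => ∑ l, a l * A l j) =
      (schur p A).updateRow ⟨i, hi⟩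
        fun j => ∑ l : {l // p l = 0}, a l * schur p A l j := by
  have hi1 : ¬ p i = 1 := by
    rw [hi]
    decide
  have hC (v : ι → R) : oddSolve p (A.updateRow i v) = oddSolve p A := by
    rw [oddSolve, toBlock_updateRow_of_ne (p := fun i => p i = 1) A hi1,
      toBlock_updateRow_of_ne (p := fun i => p i = 1) A hi1]
    rfl
  ext k j
  rw [schur_apply, hC]
  by_cases hk : k = ⟨i, hi⟩
  · subst hk
    simp only [Matrix.updateRow_self]
    let q : ι → R := fun l => A l j - ∑ k : {i // p i = 1}, A l k * oddSolve p A k j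
    have h1 : ∑ l, a l * A l j -
        ∑ k : {i // p i = 1}, (∑ l, a l * A l k) * oddSolve p A k j = ∑ l, a l * q l := by
      simp only [q, mul_sub, Finset.sum_sub_distrib, Finset.sum_mul, Finset.mul_sum, mul_assoc]
      congr 1
      exact Finset.sum_comm
    rw [h1, ← Fintype.sum_subtype_add_sum_subtype (fun l => p l = 0) fun l => a l * q l]
    simp only [schur_apply]
    rw [add_eq_left]
    refine Finset.sum_eq_zero fun l _ => ?_
    have hl : p l = 1 := by
      have := l.2
      revert this
      generalize p l = x
      revert x
      decide
    simp only [q, sum_oddSolve hU hl, sub_self, mul_zero]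
  · have hk' : (k : ι) ≠ i := fun h => hk (Subtype.ext h)
    simp only [Matrix.updateRow_ne hk, Matrix.updateRow_ne hk', schur_apply]

/-- An even matrix of format `p`, with respect to the parity automorphism `σ`. -/
def IsEvenMatrix (σ : R →+* R) (p : ι → ZMod 2) (A : Matrix ι ι R) : Prop :=
  ∀ i j, σ (A i j) = if p i = p j then A i j else -A i j

lemma map_ringInverse {m : Type*} [Fintype m] [DecidableEq m] (σ : R →+* R) {X : Matrix m m R}
    (hX : X.map σ = X) (hU : IsUnit X) : (Ring.inverse X).map σ = Ring.inverse X := by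
  obtain ⟨u, rfl⟩ := hU
  rw [Ring.inverse_unit]
  have h : Units.map (σ.mapMatrix : Matrix m m R →+* Matrix m m R).toMonoidHom u = u :=
    Units.ext hX
  have h2 := congrArg (fun v : (Matrix m m R)ˣ => (↑v⁻¹ : Matrix m m R)) h
  exact h2

omit [Fintype ι] [LinearOrder ι] in
lemma IsEvenMatrix.toBlock_map {σ : R →+* R} {p : ι → ZMod 2} {A : Matrix ι ι R}
    (hA : IsEvenMatrix σ p A) (x : ZMod 2) :
    (A.toBlock (fun i => p i = x) (fun i => p i = x)).map σ =
      A.toBlock (fun i => p i = x) (fun i => p i = x) := by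
  ext i j
  have := hA i j
  rwa [if_pos (i.2.trans j.2.symm)] at this

omit [Fintype ι] [LinearOrder ι] in
lemma IsEvenMatrix.toBlock_map_of_ne {σ : R →+* R} {p : ι → ZMod 2} {A : Matrix ι ι R}
    (hA : IsEvenMatrix σ p A) {x y : ZMod 2} (hxy : x ≠ y) :
    (A.toBlock (fun i => p i = x) (fun i => p i = y)).map σ =
      -A.toBlock (fun i => p i = x) (fun i => p i = y) := by
  ext i j
  have := hA i j
  rwa [if_neg (fun h => hxy (i.2.symm.trans (h.trans j.2)))] at this

/-- The two signs from the off-diagonal blocks cancel in `A₀₁ A₁₁⁻¹ A₁₀`. -/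
lemma IsEvenMatrix.schur_map {σ : R →+* R} {p : ι → ZMod 2} {A : Matrix ι ι R}
    (hA : IsEvenMatrix σ p A) (hU : BerDefined p A) : (schur p A).map σ = schur p A := by
  have h := map_ringInverse σ (hA.toBlock_map 1) hU
  rw [schur, Matrix.map_sub _ (map_sub σ), Matrix.map_mul, Matrix.map_mul, hA.toBlock_map,
    hA.toBlock_map_of_ne zero_ne_one, hA.toBlock_map_of_ne one_ne_zero, h, Matrix.neg_mul,
    Matrix.neg_mul, Matrix.mul_neg, neg_neg]

section Cramer

variable {σ : R →+* R} {p : ι → ZMod 2}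
  {A : Matrix ι ι R}

omit [Fintype ι] [LinearOrder ι] in
lemma mem_center_of_map (hσ : ∀ x, σ x = x → x ∈ Subring.center R) (hA : A.map σ = A) :
    ∀ i j, A i j ∈ Subring.center R :=
  fun i j => hσ _ (congrFun (congrFun hA i) j)

lemma ringInverse_mem_center {x : R} (hx : x ∈ Subring.center R) :
    Ring.inverse x ∈ Subring.center R := by
  by_cases h : IsUnit x
  · obtain ⟨u, rfl⟩ := h
    rw [Ring.inverse_unit]
    refine Subring.mem_center_iff.2 fun y => ?_
    have := Subring.mem_center_iff.1 hx y
    rw [Units.eq_inv_mul_iff_mul_eq, ← mul_assoc, ← this, Units.mul_inv_cancel_right]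
  · rw [Ring.inverse_non_unit _ h]
    exact zero_mem _

/-- The Berezinian is homogeneous in an even row, and does not change when left multiples of other
rows are added to this row. -/
theorem Ber_updateRow_sum (hσ : ∀ x, σ x = x → x ∈ Subring.center R)
    (hA : IsEvenMatrix σ p A) (hU : BerDefined p A) {i : ι} (hi : p i = 0) (a : ι → R) :
    BerDefined p (A.updateRow i fun j => ∑ l, a l * A l j) ∧
      Ber p (A.updateRow i fun j => ∑ l, a l * A l j) = a i * Ber p A := by
  have hi1 : ¬ p i = 1 := by
    rw [hi]
    decide
  have h11 (v : ι → R) := toBlock_updateRow_of_ne (p := fun i => p i = 1)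
    (q := fun i => p i = 1) A hi1 v
  refine ⟨?_, ?_⟩
  · rw [BerDefined, h11]
    exact hU
  · have h := ldet_updateRow_sum (mem_center_of_map hσ (hA.schur_map hU)) ⟨i, hi⟩
      (fun l : {l // p l = 0} => a l)
    rw [Ber_eq, Ber_eq, h11, schur_updateRow_sum hU hi, ← mul_assoc, ← h]
    congr! 3

theorem Ber_mem_center (hσ : ∀ x, σ x = x → x ∈ Subring.center R)
    (hA : IsEvenMatrix σ p A) (hU : BerDefined p A) : Ber p A ∈ Subring.center R := by
  rw [Ber_eq]
  exact mul_mem (ldet_mem_center (mem_center_of_map hσ (hA.schur_map hU)))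
    (ringInverse_mem_center (ldet_mem_center (mem_center_of_map hσ (hA.toBlock_map 1))))

end Cramer

end Determinants

/-! ### Linear systems on the superline -/

section Systems

variable {r : ℕ} {Ω : Opens (ℝ × (Fin r → ℝ))} {s : ℕ}

/-- The monomials in the odd variables. -/
def grassmannBasis (s : ℕ) : Module.Basis (Finset (Fin (s + 1))) ℝ (Grassmann s) :=
  (Pi.basisFun ℝ (Fin (s + 1))).ExteriorAlgebra

lemma stmul_smul (f : smoothFn Ω) (c : ℝ) (g : Grassmann s) :
    stmul f (c • g) = stmul (c • f) g :=
  (TensorProduct.tmul_smul c f g).trans (TensorProduct.smul_tmul' c f g)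

lemma stmul_sum {κ : Type*} (t : Finset κ) (f : smoothFn Ω) (g : κ → Grassmann s) :
    stmul f (∑ k ∈ t, g k) = ∑ k ∈ t, stmul f (g k) :=
  TensorProduct.tmul_sum _ _ _

lemma sum_stmul {κ : Type*} (t : Finset κ) (f : κ → smoothFn Ω) (g : Grassmann s) :
    stmul (∑ k ∈ t, f k) g = ∑ k ∈ t, stmul (f k) g :=
  TensorProduct.sum_tmul _ _ _

lemma exists_eq_sum_stmul (x : SFun Ω s) :
    ∃ f : Finset (Fin (s + 1)) → smoothFn Ω, x = ∑ k, stmul (f k) (grassmannBasis s k) := by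
  induction x using SFun.induction with
  | h1 f g =>
    refine ⟨fun k => (grassmannBasis s).repr g k • f, ?_⟩
    conv_lhs => rw [← (grassmannBasis s).sum_repr g, stmul_sum]
    simp only [stmul_smul]
  | h2 x y hx hy =>
    obtain ⟨f, rfl⟩ := hx
    obtain ⟨g, rfl⟩ := hy
    exact ⟨fun k => f k + g k, by simp only [add_stmul, Finset.sum_add_distrib]⟩

lemma stmul_eq_mul (f : smoothFn Ω) (g : Grassmann s) : stmul f g = stmul 1 g * stmul f 1 := by
  rw [stmul_mul_stmul, one_mul, mul_one]

variable {I : Opens ℝ} {U : Opens (Fin r → ℝ)}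

/-- Linear systems `∂_x Y = B Y` are solvable. -/
theorem exists_dx_solution (hI : (I : Set ℝ).OrdConnected) {n : ℕ}
    (B : Matrix (Fin n) (Fin n) (SFun (domain I U) s)) (z : domain I U) (c : Fin n → ℝ) :
    ∃ Y : Fin n → SFun (domain I U) s,
      (∀ i, dx _ s (Y i) = ∑ j, B i j * Y j) ∧ ∀ i, bodyAt s z (Y i) = c i := by
  -- Structure constants: `β i j l k` is the coefficient at the `k`-th monomial of `B i j` times the
  -- `l`-th monomial.
  have hβ (i j : Fin n) (l : Finset (Fin (s + 1))) :=
    exists_eq_sum_stmul (B i j * stmul 1 (grassmannBasis s l))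
  choose β hβ using hβ
  obtain ⟨y, hy, hyc⟩ := exists_smoothFn_solution hI
    (κ := Fin n × Finset (Fin (s + 1))) (fun ik jl => β ik.1 jl.1 jl.2 ik.2) z
    -- The coordinates of `c i • 1` in the monomial basis, so that the body at `z` is `c i`.
    (fun ik => c ik.1 * (grassmannBasis s).repr 1 ik.2)
  refine ⟨fun i => ∑ l, stmul (y (i, l)) (grassmannBasis s l), fun i => ?_, fun i => ?_⟩
  · have h1 (j : Fin n) : B i j * ∑ l, stmul (y (j, l)) (grassmannBasis s l) =
        ∑ l, ∑ k, stmul (β i j l k * y (j, l)) (grassmannBasis s k) := by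
      rw [Finset.mul_sum]
      refine Finset.sum_congr rfl fun l _ => ?_
      rw [stmul_eq_mul, ← mul_assoc, hβ, Finset.sum_mul]
      simp only [stmul_mul_stmul, mul_one]
    simp only [h1, map_sum, dx_stmul, hy, Fintype.sum_prod_type, sum_stmul]
    rw [Finset.sum_comm]
    exact Finset.sum_congr rfl fun j _ => Finset.sum_comm
  · have h1 (l : Finset (Fin (s + 1))) : bodyAt s z (stmul (y (i, l)) (grassmannBasis s l)) =
        c i * ExteriorAlgebra.algebraMapInv
          ((grassmannBasis s).repr 1 l • grassmannBasis s l) := by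
      rw [bodyAt_apply, body_stmul, map_smul]
      change _ * (y (i, l)).1 z = _
      rw [hyc, smul_eq_mul]
      ring
    rw [map_sum]
    simp only [h1]
    rw [← Finset.mul_sum, ← map_sum, (grassmannBasis s).sum_repr, map_one, mul_one]

/-- Linear systems `D F = A F` are solvable. -/
theorem exists_D_solution (hI : (I : Set ℝ).OrdConnected) {n : ℕ}
    (A : Matrix (Fin n) (Fin n) (SFun (domain I U) s)) (z : domain I U) (c : Fin n → ℝ) :
    ∃ F : Fin n → SFun (domain I U) s,
      (∀ i, D _ s (F i) = ∑ j, A i j * F j) ∧ ∀ i, bodyAt s z (F i) = c i := by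
  -- Applying `D` to `D F = A F` and using `D² = ∂_x` forces `∂_x F = B F` with this `B`.
  let B : Matrix (Fin n) (Fin n) (SFun (domain I U) s) := Matrix.of fun i j =>
    D _ s (A i j) + ∑ k, sigma _ s (A i k) * A k j
  obtain ⟨Y, hY, hYc⟩ := exists_dx_solution hI B z c
  let κ := kill (s := s) (domain I U) {0}
  -- At `ξ = 0` the operator `D` reduces to `∂_ξ`. Hence the equation prescribes the `ξ`-coefficient
  -- `H` of `F` from its `ξ`-free part, which is taken from `Y`.
  let H : Fin n → SFun (domain I U) s := fun i => κ (∑ j, A i j * κ (Y j))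
  let F : Fin n → SFun (domain I U) s := fun i => κ (Y i) + gen _ 0 * H i
  have hκF (i) : κ (F i) = κ (Y i) := by
    simp only [F, κ, map_add, map_mul, kill_kill, kill_gen, zero_mul, add_zero]
  have hdF (i) : dgen _ 0 (F i) = H i := by
    simp only [F, H, κ, map_add, dgen_mul, dgen_kill, dgen_gen, one_mul, mul_zero, add_zero,
      zero_add]
  have hκD (x : SFun (domain I U) s) : κ (D _ s x) = κ (dgen _ 0 x) := by
    simp only [D_apply, κ, map_add, map_mul, kill_gen, zero_mul, add_zero]
  have hκA (i) : κ (∑ j, A i j * F j) = H i := by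
    simp only [H, map_sum, map_mul, hκF]
    simp only [κ, kill_kill]
  let G : Fin n → SFun (domain I U) s := fun i => D _ s (F i) - ∑ j, A i j * F j
  have hκG (i) : κ (G i) = 0 := by
    simp only [G, map_sub, hκD, hκA, hdF]
    simp only [H, κ, kill_kill, sub_self]
  have hDG (i) : D _ s (G i) =
      dx _ s (F i) - ∑ j, B i j * F j - ∑ j, sigma _ s (A i j) * G j := by
    have h1 : ∑ j, B i j * F j = ∑ j, D _ s (A i j) * F j +
        ∑ j, sigma _ s (A i j) * ∑ k, A j k * F k := by
      simp only [B, Matrix.of_apply, add_mul, Finset.sum_add_distrib, Finset.sum_mul,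
        Finset.mul_sum, mul_assoc]
      congr 1
      exact Finset.sum_comm
    rw [h1]
    simp only [G, map_sub, map_sum, D_D, D_mul, mul_sub, Finset.sum_sub_distrib,
      Finset.sum_add_distrib]
    abel
  -- The defect `G` vanishes at `ξ = 0` by the choice of `H`. Its `ξ`-derivative there is the value
  -- of `D G`, which by `hDG` reduces to the equation for `Y` at `ξ = 0`.
  have hG (i) : G i = 0 := by
    refine eq_zero_of_kill_eq_zero (hκG i) ((hκD (G i)).symm.trans ?_)
    rw [hDG, map_sub, map_sub, map_sum, map_sum, ← dx_kill]
    change dx _ s (κ (F i)) - _ - _ = _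
    simp only [map_mul, hκF, hκG, mul_zero, Finset.sum_const_zero, sub_zero]
    rw [dx_kill, hY, map_sum]
    simp only [map_mul, κ, sub_self]
  refine ⟨F, fun i => sub_eq_zero.1 (hG i), fun i => ?_⟩
  rw [← hYc i, bodyAt_apply, bodyAt_apply]
  simp only [F, κ, map_add, map_mul, body_kill, body_gen, zero_mul, add_zero]

lemma monicOp_apply {n : ℕ} (a : ℕ → SFun Ω s) (f : SFun Ω s) :
    monicOp n a f = (D Ω s ^ n) f + ∑ i : Fin n, a (n - i) * (D Ω s ^ (i : ℕ)) f := by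
  rw [monicOp, LinearMap.add_apply, LinearMap.sum_apply]
  congr 1
  rw [Fin.sum_univ_eq_sum_range fun i => a (n - i) * (D Ω s ^ i) f]
  refine Finset.sum_nbij' (fun k => n - k) (fun i => n - i) ?_ ?_ ?_ ?_ ?_
  · intro k hk
    simp only [Finset.mem_Icc, Finset.mem_range] at *
    omega
  · intro k hk
    simp only [Finset.mem_Icc, Finset.mem_range] at *
    omega
  · intro k hk
    simp only [Finset.mem_Icc] at *
    omega
  · intro k hk
    simp only [Finset.mem_range] at *
    omega
  · intro k hk
    simp only [Finset.mem_Icc] at hk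
    rw [Nat.sub_sub_self hk.2]
    rfl

/-- The Cauchy problem for `M f = 0` at a point. -/
theorem exists_mem_ker_monicOp (hI : (I : Set ℝ).OrdConnected) {n : ℕ}
    (a : ℕ → SFun (domain I U) s) (z : domain I U) (c : Fin n → ℝ) :
    ∃ f : SFun (domain I U) s, monicOp n a f = 0 ∧
      ∀ i : Fin n, bodyAt s z ((D _ s ^ (i : ℕ)) f) = c i := by
  rcases n with _ | n
  · exact ⟨0, map_zero _, fun i => i.elim0⟩
  -- The companion matrix for order `n + 1`; its last row has index `n`.
  let A : Matrix (Fin (n + 1)) (Fin (n + 1)) (SFun (domain I U) s) := Matrix.of fun i j =>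
    if (i : ℕ) = n then -a (n + 1 - j) else if (j : ℕ) = i + 1 then 1 else 0
  obtain ⟨F, hF, hFc⟩ := exists_D_solution hI A z c
  have hD (i : ℕ) (hi : i < n + 1) : (D _ s ^ i) (F 0) = F ⟨i, hi⟩ := by
    induction i with
    | zero => rfl
    | succ i ih =>
      rw [pow_succ', Module.End.mul_apply, ih (by omega), hF,
        Finset.sum_eq_single ⟨i + 1, hi⟩]
      · have h : i ≠ n := by omega
        simp [A, h]
      · intro j _ hj
        have h : i ≠ n := by omega
        have h' : (j : ℕ) ≠ i + 1 := fun h => hj (Fin.ext h)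
        simp [A, h, h']
      · simp
  refine ⟨F 0, ?_, fun i => by rw [hD i i.2, hFc]⟩
  rw [monicOp_apply, pow_succ', Module.End.mul_apply, hD n (by omega), hF,
    ← Finset.sum_add_distrib]
  refine Finset.sum_eq_zero fun j _ => ?_
  rw [hD j j.2]
  simp [A]

end Systems

/-! ### Berezinians of even matrices with invertible body -/

section Body

variable {r : ℕ} {Ω : Opens (ℝ × (Fin r → ℝ))} {s : ℕ} {ι : Type*} [Fintype ι] [LinearOrder ι]
  {p : ι → ZMod 2}

/-- For block diagonal `M`, the corresponding block of a right inverse is a right inverse of the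
block, which suffices for square real matrices. -/
lemma isUnit_toBlock {M C : Matrix ι ι ℝ} (hMC : M * C = 1) (hM : ∀ i j, p i ≠ p j → M i j = 0)
    (x : ZMod 2) : IsUnit (M.toBlock (fun i => p i = x) (fun i => p i = x)) := by
  refine IsUnit.of_mul_eq_one (C.toBlock (fun i => p i = x) (fun i => p i = x)) ?_
  ext i j
  have h1 : ∑ k, M i k * C k j = (1 : Matrix ι ι ℝ) i j := by rw [← hMC, Matrix.mul_apply]
  rw [Matrix.mul_apply]
  simp only [Matrix.toBlock_apply]
  rw [← Fintype.sum_subtype_add_sum_subtype (fun k => p k = x) fun k => M i k * C k j] at h1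
  rw [Finset.sum_eq_zero (s := (Finset.univ : Finset {k // ¬ p k = x})) fun k _ => ?_, add_zero]
    at h1
  · rw [h1]
    simp [Matrix.one_apply, Subtype.ext_iff]
  · rw [hM i k fun h => k.2 (h.symm.trans i.2), zero_mul]

/-- Odd entries have zero body, so the body of `A` is block diagonal and the Schur complement has
the same body as the even-even block. Both factors of the Berezinian then have nonvanishing body. -/
theorem BerDefined_and_isUnit_Ber {A : Matrix ι ι (SFun Ω s)}
    (hA : IsEvenMatrix (sigma Ω s).toRingHom p A)
    (hU : ∀ z, ∃ C, A.map (bodyAt s z) * C = 1) : BerDefined p A ∧ IsUnit (Ber p A) := by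
  have hbody (z) (i j) (h : p i ≠ p j) : bodyAt s z (A i j) = 0 := by
    have h1 := hA i j
    rw [if_neg h] at h1
    rw [bodyAt_apply, body_eq_zero_of_sigma_eq_neg h1]
    rfl
  have hblock (x : ZMod 2) (z) : IsUnit
      ((A.toBlock (fun i => p i = x) (fun i => p i = x)).map (bodyAt s z)) := by
    obtain ⟨C, hC⟩ := hU z
    exact isUnit_toBlock hC (hbody z) x
  have hdet (x : ZMod 2) (z) :
      ((A.toBlock (fun i => p i = x) (fun i => p i = x)).map (bodyAt s z)).det ≠ 0 :=
    ((Matrix.isUnit_iff_isUnit_det _).1 (hblock x z)).ne_zero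
  refine ⟨isUnit_of_forall_isUnit_bodyAt (hblock 1), ?_⟩
  rw [Ber_eq]
  refine IsUnit.mul (isUnit_of_forall_bodyAt_ne_zero fun z => ?_)
    (IsUnit.ringInverse (isUnit_of_forall_bodyAt_ne_zero fun z => ?_))
  · have h01 : (A.toBlock (fun i => p i = 0) (fun i => p i = 1)).map (bodyAt s z) = 0 := by
      ext i j
      refine hbody z i j ?_
      rw [i.2, j.2]
      exact zero_ne_one
    rw [← ldet_map, ldet_eq_det, schur, Matrix.map_sub _ (map_sub _), Matrix.map_mul,
      Matrix.map_mul, h01, Matrix.zero_mul, Matrix.zero_mul, sub_zero]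
    convert hdet 0 z
  · rw [← ldet_map, ldet_eq_det]
    convert hdet 1 z

omit [Fintype ι] [LinearOrder ι] in
-- Evenness depends only on which parities agree, so every result on `Ber` transfers to `Ber*`.
lemma IsEvenMatrix.add_one {σ : SFun Ω s →+* SFun Ω s} {A : Matrix ι ι (SFun Ω s)}
    (hA : IsEvenMatrix σ p A) : IsEvenMatrix σ (fun i => p i + 1) A := by
  intro i j
  rw [hA i j]
  simp

end Body

/-! ### The Wroński matrix -/

section Wronski

variable {r : ℕ} {Ω : Opens (ℝ × (Fin r → ℝ))} {s n : ℕ} {φ : Fin n → SFun Ω s}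

lemma isEvenMatrix_wronskiMatrix (hφ : ∀ j : Fin n, φ j ∈ parity Ω s ((j : ℕ) : ZMod 2)) :
    IsEvenMatrix (sigma Ω s).toRingHom (altParity n) (wronskiMatrix φ) := by
  intro i j
  have h1 : (sigma Ω s).toRingHom (wronskiMatrix φ i j) =
      (-1) ^ (i : ℕ) * (D Ω s ^ (i : ℕ)) (sigma Ω s (φ j)) := sigma_D_pow _ _
  have h2 := hφ j
  have h01 : (0 : ZMod 2) ≠ 1 := zero_ne_one
  rw [h1, wronskiMatrix, Matrix.of_apply, altParity, altParity]
  rcases Nat.even_or_odd (i : ℕ) with hi | hi <;> rcases Nat.even_or_odd (j : ℕ) with hj | hj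
  · rw [hj.natCast_zmod_two] at h2
    rw [sigma_eq_of_mem_parity_zero h2, hi.neg_one_pow, hi.natCast_zmod_two,
      hj.natCast_zmod_two, if_pos rfl, one_mul]
  · rw [hj.natCast_zmod_two] at h2
    rw [sigma_eq_of_mem_parity_one h2, hi.neg_one_pow, hi.natCast_zmod_two,
      hj.natCast_zmod_two, if_neg h01, one_mul, map_neg]
  · rw [hj.natCast_zmod_two] at h2
    rw [sigma_eq_of_mem_parity_zero h2, hi.neg_one_pow, hi.natCast_zmod_two,
      hj.natCast_zmod_two, if_neg h01.symm, neg_one_mul]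
  · rw [hj.natCast_zmod_two] at h2
    rw [sigma_eq_of_mem_parity_one h2, hi.neg_one_pow, hi.natCast_zmod_two,
      hj.natCast_zmod_two, if_pos rfl, neg_one_mul, map_neg, neg_neg]

lemma replacedMatrix_eq {a : ℕ → SFun Ω s} (hφ : ∀ j, monicOp n a (φ j) = 0) (i : Fin n) :
    replacedMatrix φ i = (wronskiMatrix φ).updateRow i
      fun j => ∑ l : Fin n, a (n - l) * wronskiMatrix φ l j := by
  rw [replacedMatrix]
  congr 1
  funext j
  have h := hφ j
  rw [monicOp_apply] at h
  exact neg_eq_of_add_eq_zero_right h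

/-- The columns of the right inverse are the bodies of the constant coefficients, in the basis `φ`,
of the solutions with unit initial vectors at `z`. -/
theorem exists_bodyAt_wronskiMatrix_mul_eq_one {I : Opens ℝ} (hI : (I : Set ℝ).OrdConnected)
    {U : Opens (Fin r → ℝ)} {a : ℕ → SFun (domain I U) s} {φ : Fin n → SFun (domain I U) s}
    (hφ : IsKerBasis (monicOp n a) φ) (z : domain I U) :
    ∃ C, (wronskiMatrix φ).map (bodyAt s z) * C = 1 := by
  choose f hf hfz using fun l : Fin n =>
    exists_mem_ker_monicOp hI a z (fun i : Fin n => (1 : Matrix (Fin n) (Fin n) ℝ) i l)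
  choose c hc using fun l => (hφ.existsUnique (f l) (hf l)).exists
  refine ⟨Matrix.of fun j l => bodyAt s z (c l j), ?_⟩
  ext i l
  rw [← hfz l i]
  conv_rhs => rw [(hc l).2, map_sum, map_sum]
  rw [Matrix.mul_apply]
  refine Finset.sum_congr rfl fun j _ => ?_
  rw [D_pow_mul_const ((hc l).1 j), map_mul]
  rfl

/-- Cramer's rule for one of the two Berezinians. -/
theorem eq_inverse_mul_Ber {p : Fin n → ZMod 2}
    (hW : IsEvenMatrix (sigma Ω s).toRingHom p (wronskiMatrix φ))
    (hU : BerDefined p (wronskiMatrix φ)) (hU' : IsUnit (Ber p (wronskiMatrix φ)))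
    {a : ℕ → SFun Ω s} (hφ : ∀ j, monicOp n a (φ j) = 0) {i : Fin n} (hi : p i = 0) :
    BerDefined p (replacedMatrix φ i) ∧
      a (n - i) = Ring.inverse (Ber p (wronskiMatrix φ)) * Ber p (replacedMatrix φ i) := by
  have hσ (x : SFun Ω s) (hx : (sigma Ω s).toRingHom x = x) : x ∈ Subring.center (SFun Ω s) :=
    Subring.mem_center_iff.2 fun y => (commute_of_sigma_eq hx y).symm
  have h := Ber_updateRow_sum hσ hW hU hi fun l => a (n - l)
  have hr : replacedMatrix φ i = (wronskiMatrix φ).updateRow i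
      fun j => ∑ l : Fin n, a (n - l) * wronskiMatrix φ l j := replacedMatrix_eq hφ i
  have h' : BerDefined p (replacedMatrix φ i) ∧
      Ber p (replacedMatrix φ i) = a (n - i) * Ber p (wronskiMatrix φ) := by
    rw [hr]
    convert h
  refine ⟨h'.1, ?_⟩
  -- Cramer's rule yields `a * Ber`; since `Ber` is even, hence central, its inverse may be applied
  -- from the left.
  rw [h'.2, Subring.mem_center_iff.1 (Ber_mem_center hσ hW hU) (a (n - i)), ← mul_assoc,
    Ring.inverse_mul_cancel _ hU', one_mul]

end Wronski

end Superline

end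

theorem mainTheorem5 (r s n : ℕ) (I : TopologicalSpace.Opens ℝ)
    (hI : (I : Set ℝ).OrdConnected) (U : TopologicalSpace.Opens (Fin r → ℝ))
    (a : ℕ → Superline.SFun (Superline.domain I U) s) (φ : Fin n → Superline.SFun (Superline.domain I U) s)
    (hφ : Superline.IsKerBasis (Superline.monicOp n a) φ) :
    (Superline.BerDefined (Superline.altParity n) (Superline.wronskiMatrix φ) ∧
      IsUnit (Superline.wronskian φ)) ∧
    (Superline.BerStarDefined (Superline.altParity n) (Superline.wronskiMatrix φ) ∧
      IsUnit (Superline.wronskianStar φ)) ∧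
    ∀ i : Fin n,
      (Even (i : ℕ) →
        Superline.BerDefined (Superline.altParity n) (Superline.replacedMatrix φ i) ∧
        a (n - i) = Ring.inverse (Superline.wronskian φ) *
          Superline.Ber (Superline.altParity n) (Superline.replacedMatrix φ i)) ∧
      (Odd (i : ℕ) →
        Superline.BerStarDefined (Superline.altParity n) (Superline.replacedMatrix φ i) ∧
        a (n - i) = Ring.inverse (Superline.wronskianStar φ) *
          Superline.BerStar (Superline.altParity n) (Superline.replacedMatrix φ i)) := by
  have hW := Superline.isEvenMatrix_wronskiMatrix hφ.mem_parity
  have hz := Superline.exists_bodyAt_wronskiMatrix_mul_eq_one hI hφ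
  have h := Superline.BerDefined_and_isUnit_Ber hW hz
  have hStar := Superline.BerDefined_and_isUnit_Ber hW.add_one hz
  refine ⟨h, hStar, fun i => ⟨fun hi => ?_, fun hi => ?_⟩⟩
  · exact Superline.eq_inverse_mul_Ber hW h.1 h.2 hφ.mem_ker hi.natCast_zmod_two
  -- In the shifted format an odd row is even, so the same rule applies.
  · refine Superline.eq_inverse_mul_Ber hW.add_one hStar.1 hStar.2 hφ.mem_ker ?_
    rw [Superline.altParity, hi.natCast_zmod_two]
    decide
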